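/- **Setting.** A program has integer parameters $p\in\mathbb Z^k$ and finitely many statements. A statement is either a normal assignment $A[\phi_S(x,p)]=e$ or a reduction $A[\phi_S(x,p)]\mathrel{\oplus}=e$ ($\oplus$ associative and commutative), executed at all integer points $x$ of its domain $\mathcal P_S(p)=\{x\in\mathbb Z^n : a_j\cdot x+b_j\cdot p+c_j\ge 0\text{ for all }j\}$. Here $\phi_S$ and all array subscripts are affine in $(x,p)$ with integer coefficients, and $e$ is built from constants, array references and unary and binary operators. Different statements never write the same array element. An instance of a statement depends on every instance that writes an array element which it reads. An *affine schedule* gives each statement an affine map to $\mathbb Z^m$ such that, for all $p$, all dependences strictly increase the timestamp lexicographically. The *complexity* of a program is the number of its statement instances, as a function of $p$. The *augmented program* makes each reduction $S$ accumulate into a fresh array $A'_S$ and adds the statement $A[u]=A'_S[u]$ for all $u$ written by $S$; write $\Theta_{A}$ for the linear part, in $u$, of the scheduling function of this added statement. Write $\mathrm{proj}$ for the linear part of $\phi_S$ in $x$. The operator $\oplus$ *has an inverse* if there is $\ominus$ with $(a\oplus b)\ominus b=a$ for all $a,b$. **Faces and reuse vectors.** A face $f$ of $\mathcal P_S$ is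 obtained by turning a set $I$ of its inequalities into equalities (faces are indexed by these sets). A vector $r\in\mathbb Z^n$ is a *valid reuse vector* for $f$ if: - (complexity) $a_j\cdot r=0$ for every inequality $j$ such that $a_j\cdot x+b_j\cdot p+c_j$ is bounded, uniformly in $p$, on each neighbourhood of $f$ of constant thickness, that is, on the set where all inequality functions are $\ge -T$ and those in $I$ are $\le T$, for each constant $T$; - (inverse) if $\oplus$ has no inverse, then for all $p$ no index is in both $\phi_S((f+r)\setminus f)$ and $\phi_S(f\cap(f+r))$, so that reuse along $r$ needs no subtraction; - (sharing) the linear part in $x$ of every array subscript in $e$ maps $r$ to $0$; - $\mathrm{proj}(r)\neq0$, so that the reuse is between different array elements. **The transformation.** An *assignment* $\rho$ gives each face of each reduction domain a vector; $0$ means that the simplification transformation (ST) is not applied along that face. The transformed program is obtained recursively, starting from each reduction with its full domain (the face with $I=\emptyset$). Applying ST with vector $r\ne0$ to a reduction with domain $D$ replaces it by - the statements that compute the element $u$, for every $u\in\phi_S(D)$, from the element $u-\mathrm{proj}(r)$ (if $u\in\phi_S(D\cap(D+r))$), by adding and subtracting results of residual reductions; and - residual reductions of the same expression over the pieces of the half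 shells $D\setminus(D+r)$ (added) and $(D+r)\setminus D$ (subtracted). There is one piece for each inequality $j$ with $a_j\cdot r\neq0$: it consists of the points where $j$ is the first inequality of $D$ that fails, at $x-r$ in the first shell and at $x$ in the second. The piece corresponds to the face with index set $I\cup\{j\}$. Each residual reduction is treated in the same way with the vector assigned to its face. The assignment is *feasible* if all its nonzero vectors are valid for their faces and the transformed program has an affine schedule (of some dimension). A feasible assignment $\rho$ is *optimal* for the multiple-statement simplifying-reduction problem if for every feasible $\rho'$ there is a constant $C$ such that for all $p$ the complexity of the program transformed by $\rho$ is at most $C$ times that of the program transformed by $\rho'$. **The heuristic.** Given an affine schedule of the augmented program, for each face that has a valid reuse vector, pick any valid $r$. Call $r$ *consistent* if the first nonzero entry of $\Theta_A\,\mathrm{proj}(r)$ exists and is positive. If $r$ is consistent, assign $r$ to the face; otherwise assign $-r$ if $-r$ is also valid, and $0$ if not. All other faces get $0$. **Theorem.** Suppose that every reduction operator of the program has an inverse, and that an affine schedule of the augmented program is given. Then, for any choice of the picked vectors: 1. the heuristic assigns a nonzero valid reuse vector to every face that has a valid reuse vector; 2. among all feasible assignments, it maximizes the number of faces along which ST is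 applied; 3. every feasible assignment that maximizes this number is optimal, whatever vectors it uses; 4. the assignment of the heuristic is feasible and optimal for the multiple-statement simplifying-reduction problem. -/

import Mathlib

namespace MSSR

/-! ### Affine maps, arrays, expressions, programs -/

/-- An affine map `(x, p) ↦ lin x + par p + cst` with integer coefficients, from the loop variables
`x ∈ ℤⁿ` and the program parameters `p ∈ ℤᵏ` to `ℤᵈ`. -/
structure Aff (k n d : ℕ) where
  lin : Matrix (Fin d) (Fin n) ℤ
  par : Matrix (Fin d) (Fin k) ℤ
  cst : Fin d → ℤ

def Aff.eval {k n d : ℕ} (f : Aff k n d) (p : Fin k → ℤ) (x : Fin n → ℤ) : Fin d → ℤ :=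
  f.lin.mulVec x + f.par.mulVec p + f.cst

/-- The map `u ↦ u + v`. -/
def Aff.translate (k : ℕ) {d : ℕ} (v : Fin d → ℤ) : Aff k d d := ⟨1, 0, v⟩

/-- An array reference `arr[idx (x, p)]`, the array having `ar` dimensions. -/
structure Access (Arr : Type*) (k n : ℕ) where
  arr : Arr
  ar : ℕ
  idx : Aff k n ar

/-- The array element that a reference denotes at a given iteration. -/
def Access.loc {Arr : Type*} {k n : ℕ} (a : Access Arr k n) (p : Fin k → ℤ) (x : Fin n → ℤ) :
    Arr × (Σ d : ℕ, Fin d → ℤ) :=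
  (a.arr, ⟨a.ar, a.idx.eval p x⟩)

def Access.rename {Arr Arr' : Type*} {k n : ℕ} (f : Arr → Arr') (a : Access Arr k n) :
    Access Arr' k n :=
  ⟨f a.arr, a.ar, a.idx⟩

/-- Right-hand sides: constants, array references, unary and binary operators. -/
inductive Expr (V Arr : Type*) (k n : ℕ) where
  | const (v : V) : Expr V Arr k n
  | ref (a : Access Arr k n) : Expr V Arr k n
  | un (f : V → V) (e : Expr V Arr k n) : Expr V Arr k n
  | bin (f : V → V → V) (e₁ e₂ : Expr V Arr k n) : Expr V Arr k n

/-- The array references occurring in an expression. -/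
def Expr.refs {V Arr : Type*} {k n : ℕ} : Expr V Arr k n → Set (Access Arr k n)
  | .const _ => ∅
  | .ref a => {a}
  | .un _ e => e.refs
  | .bin _ e₁ e₂ => e₁.refs ∪ e₂.refs

/-- A reduction operator: an associative and commutative binary operation. -/
structure RedOp (V : Type*) where
  op : V → V → V
  assoc : ∀ a b c, op (op a b) c = op a (op b c)
  comm : ∀ a b, op a b = op b a

/-- The operator `⊕` has an inverse operator `⊖`, one with `(a ⊕ b) ⊖ b = a`. -/
def RedOp.HasInverse {V : Type*} (o : RedOp V) : Prop :=
  ∃ inv : V → V → V, ∀ a b, inv (o.op a b) b = a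

/-- A statement `lhs = rhs : domain` (if `red = none`) or `lhs ⊕= rhs : domain` (if
`red = some ⊕`), with `dim` loop variables. The domain is the polyhedral set of the integer points
`x` at which all `rows` affine functions `cons (x, p)` are nonnegative. -/
structure Stmt (V Arr : Type*) (k : ℕ) where
  dim : ℕ
  rows : ℕ
  cons : Aff k dim rows
  lhs : Access Arr k dim
  red : Option (RedOp V)
  rhs : Expr V Arr k dim

def Stmt.domain {V Arr : Type*} {k : ℕ} (S : Stmt V Arr k) (p : Fin k → ℤ) :
    Set (Fin S.dim → ℤ) :=
  {x | ∀ j, 0 ≤ S.cons.eval p x j}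

/-- A program with `k` integer parameters. -/
structure Program (V Arr : Type*) (k : ℕ) where
  size : ℕ
  stmt : Fin size → Stmt V Arr k

/-- Array static single assignment form: no array element is written by two different statements
(the iterations of one reduction may accumulate into the same element). -/
def Program.IsSSA {V Arr : Type*} {k : ℕ} (P : Program V Arr k) : Prop :=
  ∀ s t, s ≠ t → ∀ p, ∀ x ∈ (P.stmt s).domain p, ∀ y ∈ (P.stmt t).domain p,
    (P.stmt s).lhs.loc p x ≠ (P.stmt t).lhs.loc p y

/-- The reduction statements of a program. -/
abbrev Program.Red {V Arr : Type*} {k : ℕ} (P : Program V Arr k) : Type :=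
  {s : Fin P.size // (P.stmt s).red.isSome}

/-- The remaining statements, the normal assignments. -/
abbrev Program.Plain {V Arr : Type*} {k : ℕ} (P : Program V Arr k) : Type :=
  {s : Fin P.size // ¬ (P.stmt s).red.isSome}

/-! ### Statement systems: dependences, schedules, complexity

Source programs, augmented programs and transformed programs are all compared through their
statements: an iteration domain, a write access and read accesses for each. -/

structure Sys (Arr Idx : Type*) (k : ℕ) where
  dim : Idx → ℕ
  dom : ∀ σ, (Fin k → ℤ) → Set (Fin (dim σ) → ℤ)
  write : ∀ σ, Access Arr k (dim σ)
  reads : ∀ σ, Set (Access Arr k (dim σ))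

/-- Instance `x` of `σ` must happen before instance `y` of `τ`: the latter reads an array element
that the former writes (or accumulates into). -/
def Sys.Dep {Arr Idx : Type*} {k : ℕ} (S : Sys Arr Idx k) (p : Fin k → ℤ)
    (σ : Idx) (x : Fin (S.dim σ) → ℤ) (τ : Idx) (y : Fin (S.dim τ) → ℤ) : Prop :=
  x ∈ S.dom σ p ∧ y ∈ S.dom τ p ∧ ∃ a ∈ S.reads τ, a.loc p y = (S.write σ).loc p x

/-- Comparison of timestamps at the first index where they differ. -/
def LexLt {m : ℕ} (t₁ t₂ : Fin m → ℤ) : Prop :=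
  ∃ i, (∀ j < i, t₁ j = t₂ j) ∧ t₁ i < t₂ i

/-- An `m`-dimensional affine schedule: one scheduling function for each statement, such that all
dependences are respected for all parameter values. -/
def Sys.IsSchedule {Arr Idx : Type*} {k : ℕ} (S : Sys Arr Idx k) {m : ℕ}
    (Θ : ∀ σ, Aff k (S.dim σ) m) : Prop :=
  ∀ p σ x τ y, S.Dep p σ x τ y → LexLt ((Θ σ).eval p x) ((Θ τ).eval p y)

def Sys.Schedulable {Arr Idx : Type*} {k : ℕ} (S : Sys Arr Idx k) : Prop :=
  ∃ (m : ℕ) (Θ : ∀ σ, Aff k (S.dim σ) m), S.IsSchedule Θ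

/-- The number of statement instances, the sum of the cardinalities of all domains, as a function
of the parameters. -/
noncomputable def Sys.complexity {Arr Idx : Type*} {k : ℕ} (S : Sys Arr Idx k)
    (p : Fin k → ℤ) : ℕ∞ :=
  Set.encard {i : Σ σ, (Fin (S.dim σ) → ℤ) | i.2 ∈ S.dom i.1 p}

/-! ### The augmented program

Each reduction `s` with left-hand side array `A` accumulates into a fresh array `A'` (named
`inr s`), and a redirect statement `A[u] = A'[u]` is added, `u` ranging over the elements written
by `s`. The scheduling function of the redirect statement is that of the left-hand side of `s`. -/

def Program.augmented {V Arr : Type*} {k : ℕ} (P : Program V Arr k) :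
    Sys (Arr ⊕ Fin P.size) (Fin P.size ⊕ P.Red) k where
  dim
    | .inl s => (P.stmt s).dim
    | .inr s => (P.stmt s).lhs.ar
  dom
    | .inl s => (P.stmt s).domain
    | .inr s => fun p => (P.stmt s).lhs.idx.eval p '' (P.stmt s).domain p
  write
    | .inl s => (P.stmt s).lhs.rename fun A =>
        if (P.stmt s).red.isSome then Sum.inr s else Sum.inl A
    | .inr s => ⟨Sum.inl (P.stmt s).lhs.arr, (P.stmt s).lhs.ar, Aff.translate k 0⟩
  reads
    | .inl s => Access.rename Sum.inl '' (P.stmt s).rhs.refs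
    | .inr s => {⟨Sum.inr s.1, (P.stmt s).lhs.ar, Aff.translate k 0⟩}

/-! ### The two half shells and the intersection of a domain and its translate -/

/-- The translate of `D` along `r`. -/
def shift {n : ℕ} (r : Fin n → ℤ) (D : Set (Fin n → ℤ)) : Set (Fin n → ℤ) := {x | x - r ∈ D}

def addSet {n : ℕ} (r : Fin n → ℤ) (D : Set (Fin n → ℤ)) : Set (Fin n → ℤ) := D \ shift r D

def subSet {n : ℕ} (r : Fin n → ℤ) (D : Set (Fin n → ℤ)) : Set (Fin n → ℤ) := shift r D \ D

def intSet {n : ℕ} (r : Fin n → ℤ) (D : Set (Fin n → ℤ)) : Set (Fin n → ℤ) := D ∩ shift r D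

/-! ### Faces and candidate reuse vectors

A face of the domain of a statement is given by the set `I` of those inequalities that are turned
into equalities. -/

def Stmt.face {V Arr : Type*} {k : ℕ} (S : Stmt V Arr k) (I : Finset (Fin S.rows))
    (p : Fin k → ℤ) : Set (Fin S.dim → ℤ) :=
  {x ∈ S.domain p | ∀ i ∈ I, S.cons.eval p x i = 0}

/-- The neighbourhood of thickness `T` of a face; for `T = 0` it is the face itself. -/
def Stmt.thickFace {V Arr : Type*} {k : ℕ} (S : Stmt V Arr k) (I : Finset (Fin S.rows)) (T : ℕ)
    (p : Fin k → ℤ) : Set (Fin S.dim → ℤ) :=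
  {x | ∀ i, -(T : ℤ) ≤ S.cons.eval p x i ∧ (i ∈ I → S.cons.eval p x i ≤ T)}

/-- The extent of the face across the hyperplanes of inequality `j` is bounded by a constant that
does not depend on the parameters. Neighbourhoods of constant thickness are used because the
domains that correspond to a face are of this kind; if the face has an integer point for some
parameter value, this is the same as boundedness on the face itself. -/
def Stmt.ConstantExtent {V Arr : Type*} {k : ℕ} (S : Stmt V Arr k) (I : Finset (Fin S.rows))
    (j : Fin S.rows) : Prop :=
  ∀ T : ℕ, ∃ M : ℤ, ∀ p, ∀ x ∈ S.thickFace I T p, S.cons.eval p x j ≤ M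

/-- The complexity condition: `r` lies in the space of directions in which the face has no constant
thickness (in particular, `r` is parallel to the face). -/
def Stmt.complexitySet {V Arr : Type*} {k : ℕ} (S : Stmt V Arr k) (I : Finset (Fin S.rows)) :
    Set (Fin S.dim → ℤ) :=
  {r | ∀ j, S.ConstantExtent I j → S.cons.lin.mulVec r j = 0}

/-- The inverse condition: if the operator has no inverse, then no element of the left-hand side
array that is computed by reuse along `r` needs a subtraction. -/
def Stmt.inverseSet {V Arr : Type*} {k : ℕ} (S : Stmt V Arr k) (I : Finset (Fin S.rows)) :
    Set (Fin S.dim → ℤ) :=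
  {r | ∀ o, S.red = some o → ¬ o.HasInverse → ∀ p,
    Disjoint (S.lhs.idx.eval p '' subSet r (S.face I p))
      (S.lhs.idx.eval p '' intSet r (S.face I p))}

/-- The sharing condition: `r` lies in the share space, so that a translation by `r` changes no
array reference of the right-hand side. -/
def Stmt.sharingSet {V Arr : Type*} {k : ℕ} (S : Stmt V Arr k) : Set (Fin S.dim → ℤ) :=
  {r | ∀ a ∈ S.rhs.refs, a.idx.lin.mulVec r = 0}

/-- The projection of `r` to the index space of the left-hand side array. -/
def Stmt.proj {V Arr : Type*} {k : ℕ} (S : Stmt V Arr k) (r : Fin S.dim → ℤ) :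
    Fin S.lhs.ar → ℤ :=
  S.lhs.idx.lin.mulVec r

/-- The valid reuse vectors for a face. The reuse has to be between different elements of the
left-hand side array, whence the last condition, which also forces `r ≠ 0`. -/
def Stmt.candidates {V Arr : Type*} {k : ℕ} (S : Stmt V Arr k) (I : Finset (Fin S.rows)) :
    Set (Fin S.dim → ℤ) :=
  (S.complexitySet I ∩ S.inverseSet I ∩ S.sharingSet) ∩ {r | S.proj r ≠ 0}

/-- An assignment of a vector to every face of the domain of every reduction; the vector `0` means
that the simplification transformation is not applied along the face. -/
abbrev Program.Assignment {V Arr : Type*} {k : ℕ} (P : Program V Arr k) : Type :=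
  ∀ s : P.Red, Finset (Fin (P.stmt s).rows) → (Fin (P.stmt s).dim → ℤ)

/-! ### Recursive application of the simplification transformation

All domains that occur are cut out by lower and upper bounds on the functions that define the
domain of the original reduction. -/

structure Box (m : ℕ) where
  lo : Fin m → ℤ
  hi : Fin m → WithTop ℤ

def Box.toSet {k n m : ℕ} (b : Box m) (f : Aff k n m) (p : Fin k → ℤ) : Set (Fin n → ℤ) :=
  {x | ∀ j, b.lo j ≤ f.eval p x j ∧ (f.eval p x j : WithTop ℤ) ≤ b.hi j}

/-- With `g i` the increment along `r` of the function number `i`: the part of `D \ (D + r)` where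
`j` is the first inequality of `D` that fails at `x - r`. -/
def Box.addPiece {m : ℕ} (b : Box m) (g : Fin m → ℤ) (j : Fin m) : Box m where
  lo i := if i < j then max (b.lo i) (b.lo i + g i) else b.lo i
  hi := Function.update b.hi j ((b.lo j + g j - 1 : ℤ) : WithTop ℤ)

/-- The part of `(D + r) \ D` where `j` is the first inequality of `D` that fails at `x`. -/
def Box.subPiece {m : ℕ} (b : Box m) (g : Fin m → ℤ) (j : Fin m) : Box m where
  lo i := if i < j then max (b.lo i) (b.lo i + g i) else b.lo i + g i
  hi := Function.update b.hi j ((b.lo j - 1 : ℤ) : WithTop ℤ)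

theorem Aff.eval_sub {k n d : ℕ} (f : Aff k n d) (p : Fin k → ℤ) (x r : Fin n → ℤ) (i : Fin d) :
    f.eval p (x - r) i = f.eval p x i - f.lin.mulVec r i := by
  simp only [Aff.eval, Matrix.mulVec_sub, Pi.add_apply, Pi.sub_apply]
  ring

/-- If `r` is parallel to the inequalities that have an upper bound, then the pieces for `g j > 0`
make up the half shell `D \ (D + r)`. -/
theorem Box.mem_addSet_iff {k n m : ℕ} (b : Box m) (f : Aff k n m) (p : Fin k → ℤ)
    (r : Fin n → ℤ) (hr : ∀ i, b.hi i ≠ ⊤ → f.lin.mulVec r i = 0) (x : Fin n → ℤ) :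
    x ∈ addSet r (b.toSet f p) ↔
      ∃ j, 0 < f.lin.mulVec r j ∧ x ∈ (b.addPiece (f.lin.mulVec r) j).toSet f p := by
  simp only [addSet, shift, Box.toSet, Set.mem_sdiff, Set.mem_ofPred_eq, Aff.eval_sub, Box.addPiece]
  generalize f.lin.mulVec r = g at *
  generalize f.eval p x = v
  constructor
  · rintro ⟨hD, hn⟩
    have hex : ∃ j, v j - g j < b.lo j := by
      by_contra hcon
      push Not at hcon
      refine hn fun j => ⟨hcon j, ?_⟩
      by_cases hj : b.hi j = ⊤
      · simp [hj]
      · simpa [hr j hj] using (hD j).2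
    obtain ⟨j, hj, hmin⟩ := exists_minimal_of_wellFoundedLT (fun j => v j - g j < b.lo j) hex
    have hlow : ∀ i < j, b.lo i ≤ v i - g i := by
      intro i hi
      by_contra hc
      exact absurd (hmin (not_le.mp hc) hi.le) (not_le.mpr hi)
    refine ⟨j, by have := (hD j).1; omega, fun i => ⟨?_, ?_⟩⟩
    · split_ifs with hij
      · exact max_le (hD i).1 (by have := hlow i hij; omega)
      · exact (hD i).1
    · by_cases hij : i = j
      · subst hij
        rw [Function.update_self]
        exact_mod_cast (by omega : v i ≤ b.lo i + g i - 1)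
      · rw [Function.update_of_ne hij]
        exact (hD i).2
  · rintro ⟨j, hg, h⟩
    have hj := (h j).2
    rw [Function.update_self] at hj
    have hj' : v j ≤ b.lo j + g j - 1 := by exact_mod_cast hj
    refine ⟨fun i => ⟨?_, ?_⟩, fun hc => ?_⟩
    · have := (h i).1
      split_ifs at this with hij
      · exact (le_max_left _ _).trans this
      · exact this
    · by_cases hij : i = j
      · subst hij
        by_cases ht : b.hi i = ⊤
        · simp [ht]
        · exact absurd (hr i ht) hg.ne'
      · simpa [Function.update_of_ne hij] using (h i).2
    · have := (hc j).1
      omega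

/-- Likewise, the pieces for `g j < 0` make up the half shell `(D + r) \ D`. -/
theorem Box.mem_subSet_iff {k n m : ℕ} (b : Box m) (f : Aff k n m) (p : Fin k → ℤ)
    (r : Fin n → ℤ) (hr : ∀ i, b.hi i ≠ ⊤ → f.lin.mulVec r i = 0) (x : Fin n → ℤ) :
    x ∈ subSet r (b.toSet f p) ↔
      ∃ j, f.lin.mulVec r j < 0 ∧ x ∈ (b.subPiece (f.lin.mulVec r) j).toSet f p := by
  simp only [subSet, shift, Box.toSet, Set.mem_sdiff, Set.mem_ofPred_eq, Aff.eval_sub, Box.subPiece]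
  generalize f.lin.mulVec r = g at *
  generalize f.eval p x = v
  constructor
  · rintro ⟨hD, hn⟩
    have hhi : ∀ i, (v i : WithTop ℤ) ≤ b.hi i := by
      intro i
      by_cases hi : b.hi i = ⊤
      · simp [hi]
      · simpa [hr i hi] using (hD i).2
    have hex : ∃ j, v j < b.lo j := by
      by_contra hcon
      push Not at hcon
      exact hn fun j => ⟨hcon j, hhi j⟩
    obtain ⟨j, hj, hmin⟩ := exists_minimal_of_wellFoundedLT (fun j => v j < b.lo j) hex
    have hlow : ∀ i < j, b.lo i ≤ v i := by
      intro i hi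
      by_contra hc
      exact absurd (hmin (not_le.mp hc) hi.le) (not_le.mpr hi)
    refine ⟨j, by have := (hD j).1; omega, fun i => ⟨?_, ?_⟩⟩
    · have := (hD i).1
      split_ifs with hij
      · exact max_le (hlow i hij) (by omega)
      · omega
    · by_cases hij : i = j
      · subst hij
        rw [Function.update_self]
        exact_mod_cast (by omega : v i ≤ b.lo i - 1)
      · rw [Function.update_of_ne hij]
        exact hhi i
  · rintro ⟨j, hg, h⟩
    have hj := (h j).2
    rw [Function.update_self] at hj
    have hj' : v j ≤ b.lo j - 1 := by exact_mod_cast hj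
    refine ⟨fun i => ⟨?_, ?_⟩, fun hc => ?_⟩
    · have := (h i).1
      split_ifs at this with hij
      · have := (le_max_right _ _).trans this
        omega
      · omega
    · by_cases ht : b.hi i = ⊤
      · simp [ht]
      · have hij : i ≠ j := fun hij => absurd (hr i ht) (hij ▸ hg.ne)
        simpa [Function.update_of_ne hij, hr i ht] using (h i).2
    · have := (hc j).1
      omega

/-- The domain at a position of the recursion. A position is the list of the inequalities whose
facets were passed on the way from the full domain, the last one first; it corresponds to the face
`π.toFinset`, and the vector that is used there is the one assigned to that face. -/
def Stmt.subdomain {V Arr : Type*} {k : ℕ} (S : Stmt V Arr k)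
    (ρ : Finset (Fin S.rows) → (Fin S.dim → ℤ)) : List (Fin S.rows) → Box S.rows
  | [] => ⟨fun _ => 0, fun _ => ⊤⟩
  | j :: π =>
    let g := S.cons.lin.mulVec (ρ π.toFinset)
    if 0 < g j then (S.subdomain ρ π).addPiece g j else (S.subdomain ρ π).subPiece g j

/-- `j` gives a residual reduction when the transformation is applied at the position `π`: the
facet number `j` is not parallel to the vector used there. -/
def Stmt.IsChild {V Arr : Type*} {k : ℕ} (S : Stmt V Arr k)
    (ρ : Finset (Fin S.rows) → (Fin S.dim → ℤ)) (π : List (Fin S.rows)) (j : Fin S.rows) : Prop :=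
  j ∉ π ∧ S.cons.lin.mulVec (ρ π.toFinset) j ≠ 0

/-- The positions that the recursion reaches. -/
def Stmt.Reached {V Arr : Type*} {k : ℕ} (S : Stmt V Arr k)
    (ρ : Finset (Fin S.rows) → (Fin S.dim → ℤ)) : List (Fin S.rows) → Prop
  | [] => True
  | j :: π => S.Reached ρ π ∧ S.IsChild ρ π j

/-- The five statements that compute the left-hand side after one application. -/
inductive Role where
  | addOnly | reuseOnly | addReuse | reuseSub | addReuseSub

def Role.usesAdd : Role → Prop
  | .addOnly | .addReuse | .addReuseSub => True
  | _ => False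

def Role.usesSub : Role → Prop
  | .reuseSub | .addReuseSub => True
  | _ => False

def Role.usesReuse : Role → Prop
  | .addOnly => False
  | _ => True

/-- Their domains, in terms of the projections of the two half shells and of the intersection. -/
def Role.dom {d : ℕ} (add sub int : Set (Fin d → ℤ)) : Role → Set (Fin d → ℤ)
  | .addOnly => add \ int
  | .reuseOnly => int \ (add ∪ sub)
  | .addReuse => add ∩ (int \ sub)
  | .reuseSub => sub ∩ (int \ add)
  | .addReuseSub => sub ∩ int ∩ add

/-- The statements of the transformed program: the normal assignments; the residual reductions to
which the transformation is not applied any more (for the position `[]`: the original reduction, if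
the transformation is not applied to it at all); and the statements that compute the result of a
reduction from the residual ones and by reuse. -/
inductive TIdx {V Arr : Type*} {k : ℕ} (P : Program V Arr k) where
  | plain (s : P.Plain) : TIdx P
  | residual (s : P.Red) (π : List (Fin (P.stmt s).rows)) : TIdx P
  | combine (s : P.Red) (π : List (Fin (P.stmt s).rows)) (c : Role) : TIdx P

/-- The array that receives the result of the reduction at a position: the original array at the
start, a fresh one for each residual reduction. -/
def Program.arrayAt {V Arr : Type*} {k : ℕ} (P : Program V Arr k) (s : P.Red) :
    List (Fin (P.stmt s).rows) → Arr ⊕ (Σ s : P.Red, List (Fin (P.stmt s).rows))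
  | [] => Sum.inl (P.stmt s).lhs.arr
  | j :: π => Sum.inr ⟨s, j :: π⟩

/-- The program obtained by applying the simplification transformation recursively with the vectors
given by `ρ`. With the vector `r`, the element `u` of the array at a position is computed from the
element `u - proj r` of the same array, and from the elements `u` of the arrays of the residual
reductions over the pieces of `D \ (D + r)`, which are added, and of `(D + r) \ D`, which are
subtracted. Positions that are not reached have empty domains. -/
def Program.transformed {V Arr : Type*} {k : ℕ} (P : Program V Arr k) (ρ : P.Assignment) :
    Sys (Arr ⊕ (Σ s : P.Red, List (Fin (P.stmt s).rows))) (TIdx P) k where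
  dim
    | .plain s => (P.stmt s).dim
    | .residual s _ => (P.stmt s).dim
    | .combine s _ _ => (P.stmt s).lhs.ar
  dom
    | .plain s => (P.stmt s).domain
    | .residual s π => fun p =>
        {x | (P.stmt s).Reached (ρ s) π ∧ ρ s π.toFinset = 0 ∧
          x ∈ ((P.stmt s).subdomain (ρ s) π).toSet (P.stmt s).cons p}
    | .combine s π c => fun p =>
        let D := ((P.stmt s).subdomain (ρ s) π).toSet (P.stmt s).cons p
        let r := ρ s π.toFinset
        let proj := (P.stmt s).lhs.idx.eval p
        {u | (P.stmt s).Reached (ρ s) π ∧ r ≠ 0 ∧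
          u ∈ c.dom (proj '' addSet r D) (proj '' subSet r D) (proj '' intSet r D)}
  write
    | .plain s => (P.stmt s).lhs.rename Sum.inl
    | .residual s π => ⟨P.arrayAt s π, (P.stmt s).lhs.ar, (P.stmt s).lhs.idx⟩
    | .combine s π _ => ⟨P.arrayAt s π, (P.stmt s).lhs.ar, Aff.translate k 0⟩
  reads
    | .plain s => Access.rename Sum.inl '' (P.stmt s).rhs.refs
    | .residual s _ => Access.rename Sum.inl '' (P.stmt s).rhs.refs
    | .combine s π c =>
        let r := ρ s π.toFinset
        let g := (P.stmt s).cons.lin.mulVec r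
        {a | (c.usesReuse ∧
              a = ⟨P.arrayAt s π, (P.stmt s).lhs.ar, Aff.translate k (-(P.stmt s).proj r)⟩) ∨
          ∃ j, (P.stmt s).IsChild (ρ s) π j ∧ ((c.usesAdd ∧ 0 < g j) ∨ (c.usesSub ∧ g j < 0)) ∧
            a = ⟨P.arrayAt s (j :: π), (P.stmt s).lhs.ar, Aff.translate k 0⟩}

/-! ### The optimization problem and the heuristic -/

/-- Feasible assignments: every vector used is valid for its face, and the transformed program has
an affine schedule that respects its dependences. -/
def Program.Feasible {V Arr : Type*} {k : ℕ} (P : Program V Arr k) (ρ : P.Assignment) : Prop :=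
  (∀ s I, ρ s I ≠ 0 → ρ s I ∈ (P.stmt s).candidates I) ∧ (P.transformed ρ).Schedulable

/-- Optimality: the assignment is feasible, and the complexity of the program it gives is at most a
constant (independent of the parameters) times the one that any other feasible assignment gives. -/
def Program.IsOptimal {V Arr : Type*} {k : ℕ} (P : Program V Arr k) (ρ : P.Assignment) : Prop :=
  P.Feasible ρ ∧ ∀ ρ' : P.Assignment, P.Feasible ρ' →
    ∃ C : ℕ, ∀ p, (P.transformed ρ).complexity p ≤ C * (P.transformed ρ').complexity p

/-- The faces along which the simplification transformation is applied. -/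
def Program.appliedFaces {V Arr : Type*} {k : ℕ} (P : Program V Arr k) (ρ : P.Assignment) :
    Set (Σ s : P.Red, Finset (Fin (P.stmt s).rows)) :=
  {f | ρ f.1 f.2 ≠ 0}

/-- `r` is consistent with the schedule of the augmented program: the first nonzero entry of the
image of `proj r` under the linear part of the scheduling function of the left-hand side of `s`
(that is, of its redirect statement) is positive. -/
def Program.Consistent {V Arr : Type*} {k : ℕ} (P : Program V Arr k) {m : ℕ}
    (Θ : ∀ σ, Aff k (P.augmented.dim σ) m) (s : P.Red) (r : Fin (P.stmt s).dim → ℤ) : Prop :=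
  LexLt 0 ((Θ (Sum.inr s)).lin.mulVec ((P.stmt s).proj r))

open Classical in
/-- The heuristic algorithm. For each face that has a candidate it starts from the candidate `pick`;
if this is not consistent with the schedule, it takes the negative, if that is a candidate too, and
does not apply the transformation otherwise. -/
noncomputable def Program.heuristic {V Arr : Type*} {k : ℕ} (P : Program V Arr k) {m : ℕ}
    (Θ : ∀ σ, Aff k (P.augmented.dim σ) m) (pick : P.Assignment) : P.Assignment := fun s I =>
  if ((P.stmt s).candidates I).Nonempty then
    if P.Consistent Θ s (pick s I) then pick s I
    else if -(pick s I) ∈ (P.stmt s).candidates I then -(pick s I)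
    else 0
  else 0

end MSSR

/-!
**Feasibility of the heuristic.** Since every operator has an inverse, the valid reuse vectors of a
face are closed under negation. Timestamps are totally ordered, so of a vector and its negative one
does not move backwards under the linear part of the schedule of the augmented program
(`Program.heuristic_advance_nonneg`). With such vectors the schedule of the augmented program
extends to the transformed one (`Program.transformed_isSchedule`). A residual reduction may run over
points outside the original domain, because subtracted pieces lie in translates; but it reads there
what the original reduction reads at the point from which it has drifted (`Stmt.drift`), so it is
scheduled at the time of that point, and the drift only moves the left-hand side forward. The
statements that combine results are scheduled at the time of the left-hand side; two further
coordinates put deeper positions first, and order the reuse along vectors that leave the time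
unchanged.

**Optimality.** The heuristic uses every face that a feasible assignment can use, so a maximal
feasible assignment uses exactly the faces with a valid reuse vector. Let `ρ` be one and let `ρ'` be
any feasible assignment. The number of combining instances of `ρ` at a position is at most the
number of elements of the original left-hand side, and `ρ'`, too, computes all of these. A residual
reduction that `ρ` leaves lies near a face `I` without a valid reuse vector. Hence each vector that
`ρ'` uses at some position, although it shares and has a nonzero projection, is not parallel to some
inequality across which `I` has constant extent. Starting from a point near `I`, a bounded number
of steps along this vector, in the direction in which that inequality decreases, therefore leaves
the domain at this position, which means that a piece of one of the half shells is reached. After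
at most as many descents as there are inequalities, the point is, up to one of finitely many
displacements, an instance of a residual reduction of `ρ'` (`Stmt.Valid.exists_residual_near`). The
displacements do not depend on the parameters, which gives the constant factor
(`Program.complexity_le_of_applied`).
-/

namespace MSSR

/-! ### Affine maps and lexicographic comparison -/

theorem Aff.eval_add {k n d : ℕ} (f : Aff k n d) (p : Fin k → ℤ) (x r : Fin n → ℤ) :
    f.eval p (x + r) = f.eval p x + f.lin.mulVec r := by
  simp only [Aff.eval, Matrix.mulVec_add]
  abel

theorem Aff.eval_add_zsmul {k n d : ℕ} (f : Aff k n d) (p : Fin k → ℤ) (x r : Fin n → ℤ) (z : ℤ)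
    (i : Fin d) : f.eval p (x + z • r) i = f.eval p x i + z * f.lin.mulVec r i := by
  rw [Aff.eval_add, Matrix.mulVec_smul]
  simp

theorem Aff.eval_translate {k d : ℕ} (v : Fin d → ℤ) (p : Fin k → ℤ) (u : Fin d → ℤ) :
    (Aff.translate k v).eval p u = u + v := by
  simp [Aff.eval, Aff.translate]

/-- The affine map `(x, p) ↦ f (x - v, p)`. -/
def Aff.delay {k n d : ℕ} (f : Aff k n d) (v : Fin n → ℤ) : Aff k n d :=
  ⟨f.lin, f.par, f.cst - f.lin.mulVec v⟩

theorem Aff.eval_delay {k n d : ℕ} (f : Aff k n d) (v : Fin n → ℤ) (p : Fin k → ℤ)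
    (x : Fin n → ℤ) : (f.delay v).eval p x = f.eval p (x - v) := by
  simp only [Aff.eval, Aff.delay, Matrix.mulVec_sub]
  abel

/-- `f` with the further coordinate `x ↦ w ⬝ x + c` at the end. -/
def Aff.snoc {k n d : ℕ} (f : Aff k n d) (w : Fin n → ℤ) (c : ℤ) : Aff k n (d + 1) :=
  ⟨Matrix.of (Fin.snoc (α := fun _ => Fin n → ℤ) f.lin.row w),
    Matrix.of (Fin.snoc (α := fun _ => Fin k → ℤ) f.par.row 0), Fin.snoc f.cst c⟩

theorem Aff.eval_snoc {k n d : ℕ} (f : Aff k n d) (w : Fin n → ℤ) (c : ℤ) (p : Fin k → ℤ)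
    (x : Fin n → ℤ) :
    (f.snoc w c).eval p x = (Fin.snoc (f.eval p x) (w ⬝ᵥ x + c) : Fin (d + 1) → ℤ) := by
  funext i
  refine Fin.lastCases ?_ (fun i => ?_) i
  · change Fin.snoc (α := fun _ => Fin n → ℤ) f.lin.row w (Fin.last d) ⬝ᵥ x +
      Fin.snoc (α := fun _ => Fin k → ℤ) f.par.row 0 (Fin.last d) ⬝ᵥ p +
      Fin.snoc (α := fun _ => ℤ) f.cst c (Fin.last d) = _
    simp only [Fin.snoc_last, zero_dotProduct, add_zero]
  · change Fin.snoc (α := fun _ => Fin n → ℤ) f.lin.row w i.castSucc ⬝ᵥ x +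
      Fin.snoc (α := fun _ => Fin k → ℤ) f.par.row 0 i.castSucc ⬝ᵥ p +
      Fin.snoc (α := fun _ => ℤ) f.cst c i.castSucc = _
    simp only [Fin.snoc_castSucc]
    rfl

theorem Aff.eval_snoc_snoc {k n d : ℕ} (f : Aff k n d) (w w' : Fin n → ℤ) (c c' : ℤ)
    (p : Fin k → ℤ) (x : Fin n → ℤ) : ((f.snoc w c).snoc w' c').eval p x =
      (Fin.snoc (Fin.snoc (f.eval p x) (w ⬝ᵥ x + c) : Fin (d + 1) → ℤ) (w' ⬝ᵥ x + c') :
        Fin (d + 1 + 1) → ℤ) := by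
  rw [Aff.eval_snoc, Aff.eval_snoc]

theorem Access.loc_translate {Arr : Type*} {k d : ℕ} (A : Arr) (v : Fin d → ℤ) (p : Fin k → ℤ)
    (u : Fin d → ℤ) :
    (⟨A, d, Aff.translate k v⟩ : Access Arr k d).loc p u = (A, ⟨d, u + v⟩) := by
  rw [Access.loc, Aff.eval_translate]

theorem Access.loc_translate_zero {Arr : Type*} {k d : ℕ} (A : Arr) (p : Fin k → ℤ)
    (u : Fin d → ℤ) :
    (⟨A, d, Aff.translate k 0⟩ : Access Arr k d).loc p u = (A, ⟨d, u⟩) := by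
  rw [Access.loc_translate, add_zero]

theorem Access.loc_rename {Arr Arr' : Type*} {k n : ℕ} (f : Arr → Arr') (a : Access Arr k n)
    (p : Fin k → ℤ) (x : Fin n → ℤ) : (a.rename f).loc p x = (f (a.loc p x).1, (a.loc p x).2) :=
  rfl

theorem lexLt_iff {m : ℕ} {a b : Fin m → ℤ} : LexLt a b ↔ toLex a < toLex b := Iff.rfl

theorem LexLt.snoc {m : ℕ} {a b : Fin m → ℤ} (h : LexLt a b) (c d : ℤ) :
    LexLt (Fin.snoc a c : Fin (m + 1) → ℤ) (Fin.snoc b d : Fin (m + 1) → ℤ) := by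
  obtain ⟨i, hlt, hi⟩ := h
  refine ⟨i.castSucc, fun j hj => ?_, by simpa using hi⟩
  have hjm : (j : ℕ) < m := lt_trans (Fin.lt_def.mp hj) (by simp)
  obtain ⟨j, rfl⟩ : ∃ j' : Fin m, j = j'.castSucc := ⟨⟨j, hjm⟩, rfl⟩
  simpa using hlt j (by simpa using hj)

theorem lexLt_snoc_of_lt {m : ℕ} (a : Fin m → ℤ) {c d : ℤ} (h : c < d) :
    LexLt (Fin.snoc a c : Fin (m + 1) → ℤ) (Fin.snoc a d : Fin (m + 1) → ℤ) := by
  refine ⟨Fin.last m, fun j hj => ?_, by simpa using h⟩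
  obtain ⟨j, rfl⟩ : ∃ j' : Fin m, j = j'.castSucc := ⟨⟨j, by simpa [Fin.lt_def] using hj⟩, rfl⟩
  simp

theorem LexLt.add_nonneg {m : ℕ} {a b v : Fin m → ℤ} (h : LexLt a b) (hv : 0 ≤ toLex v) :
    LexLt a (b + v) := by
  have := add_lt_add_of_lt_of_le (lexLt_iff.mp h) hv
  rwa [add_zero] at this

/-! ### Domains in the recursion -/

section Stmt
variable {V Arr : Type*} {k : ℕ} {S : Stmt V Arr k}
  {ρ : Finset (Fin S.rows) → (Fin S.dim → ℤ)}

/-- All vectors that are used are valid for their faces. -/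
def Stmt.Valid (S : Stmt V Arr k) (ρ : Finset (Fin S.rows) → (Fin S.dim → ℤ)) : Prop :=
  ∀ I, ρ I ≠ 0 → ρ I ∈ S.candidates I

theorem Stmt.constantExtent_of_mem {I : Finset (Fin S.rows)} {i : Fin S.rows} (hi : i ∈ I) :
    S.ConstantExtent I i :=
  fun T => ⟨T, fun _ _ hx => (hx i).2 hi⟩

theorem Stmt.Valid.lin_eq_zero (h : S.Valid ρ) {I : Finset (Fin S.rows)} {j : Fin S.rows}
    (hj : S.ConstantExtent I j) : S.cons.lin.mulVec (ρ I) j = 0 := by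
  by_cases h0 : ρ I = 0
  · simp [h0]
  · exact (h I h0).1.1.1 j hj

theorem Stmt.Valid.ref_eq_zero (h : S.Valid ρ) (I : Finset (Fin S.rows)) :
    ρ I ∈ S.sharingSet := by
  by_cases h0 : ρ I = 0
  · intro a _
    simp [h0]
  · exact (h I h0).1.2

theorem Stmt.subdomain_hi_ne_top {π : List (Fin S.rows)} {i : Fin S.rows} :
    (S.subdomain ρ π).hi i ≠ ⊤ ↔ i ∈ π := by
  induction π with
  | nil => simp [Stmt.subdomain]
  | cons j π ih =>
    by_cases hij : i = j
    · subst hij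
      simp only [Stmt.subdomain]
      split_ifs <;> simp [Box.addPiece, Box.subPiece]
    · have : (S.subdomain ρ (j :: π)).hi i = (S.subdomain ρ π).hi i := by
        simp only [Stmt.subdomain]
        split_ifs <;> simp [Box.addPiece, Box.subPiece, hij]
      rw [this, ih]
      simp [hij]

theorem Stmt.Valid.parallel (h : S.Valid ρ) (π : List (Fin S.rows)) (i : Fin S.rows)
    (hi : (S.subdomain ρ π).hi i ≠ ⊤) : S.cons.lin.mulVec (ρ π.toFinset) i = 0 :=
  h.lin_eq_zero (Stmt.constantExtent_of_mem (by simpa using Stmt.subdomain_hi_ne_top.mp hi))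

/-- The set of integer points of the domain at a position of the recursion. -/
def Stmt.piece (S : Stmt V Arr k) (ρ : Finset (Fin S.rows) → (Fin S.dim → ℤ))
    (π : List (Fin S.rows)) (p : Fin k → ℤ) : Set (Fin S.dim → ℤ) :=
  (S.subdomain ρ π).toSet S.cons p

theorem Stmt.piece_nil (p : Fin k → ℤ) : S.piece ρ [] p = S.domain p := by
  ext x
  simp [Stmt.piece, Stmt.subdomain, Box.toSet, Stmt.domain]

theorem Stmt.Reached.nodup {π : List (Fin S.rows)} (h : S.Reached ρ π) : π.Nodup := by
  induction π with
  | nil => simp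
  | cons j π ih => exact List.nodup_cons.mpr ⟨h.2.1, ih h.1⟩

theorem Stmt.Valid.mem_addSet (h : S.Valid ρ) {π : List (Fin S.rows)} {j : Fin S.rows}
    (hj : 0 < S.cons.lin.mulVec (ρ π.toFinset) j) {p : Fin k → ℤ} {x : Fin S.dim → ℤ}
    (hx : x ∈ S.piece ρ (j :: π) p) : x ∈ addSet (ρ π.toFinset) (S.piece ρ π p) := by
  refine (Box.mem_addSet_iff _ _ _ _ (h.parallel π) x).mpr ⟨j, hj, ?_⟩
  simpa only [Stmt.piece, Stmt.subdomain, if_pos hj] using hx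

theorem Stmt.Valid.mem_subSet (h : S.Valid ρ) {π : List (Fin S.rows)} {j : Fin S.rows}
    (hj : S.cons.lin.mulVec (ρ π.toFinset) j < 0) {p : Fin k → ℤ} {x : Fin S.dim → ℤ}
    (hx : x ∈ S.piece ρ (j :: π) p) : x ∈ subSet (ρ π.toFinset) (S.piece ρ π p) := by
  refine (Box.mem_subSet_iff _ _ _ _ (h.parallel π) x).mpr ⟨j, hj, ?_⟩
  simpa only [Stmt.piece, Stmt.subdomain, if_neg hj.not_gt] using hx

theorem Stmt.Valid.isChild (h : S.Valid ρ) {π : List (Fin S.rows)} {j : Fin S.rows}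
    (hj : S.cons.lin.mulVec (ρ π.toFinset) j ≠ 0) : S.IsChild ρ π j :=
  ⟨fun hmem => hj (h.parallel π j (Stmt.subdomain_hi_ne_top.mpr hmem)), hj⟩

/-- Both half shells are covered by the domains of the residual reductions. -/
theorem Stmt.Valid.exists_child (h : S.Valid ρ) {π : List (Fin S.rows)} {p : Fin k → ℤ}
    {x : Fin S.dim → ℤ} (hx : x ∈ addSet (ρ π.toFinset) (S.piece ρ π p) ∨
      x ∈ subSet (ρ π.toFinset) (S.piece ρ π p)) :
    ∃ j, S.IsChild ρ π j ∧ x ∈ S.piece ρ (j :: π) p := by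
  rcases hx with hx | hx
  · obtain ⟨j, hj, hxj⟩ := (Box.mem_addSet_iff _ _ _ _ (h.parallel π) x).mp hx
    refine ⟨j, h.isChild hj.ne', ?_⟩
    simpa only [Stmt.piece, Stmt.subdomain, if_pos hj] using hxj
  · obtain ⟨j, hj, hxj⟩ := (Box.mem_subSet_iff _ _ _ _ (h.parallel π) x).mp hx
    refine ⟨j, h.isChild hj.ne, ?_⟩
    simpa only [Stmt.piece, Stmt.subdomain, if_neg hj.not_gt] using hxj

/-- The total displacement from the original domain of the domain at a position: a subtracted piece
lies in the translate of its parent along the vector used there, an added piece in the parent. -/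
def Stmt.drift (S : Stmt V Arr k) (ρ : Finset (Fin S.rows) → (Fin S.dim → ℤ)) :
    List (Fin S.rows) → (Fin S.dim → ℤ)
  | [] => 0
  | j :: π =>
    if 0 < S.cons.lin.mulVec (ρ π.toFinset) j then S.drift ρ π
    else S.drift ρ π + ρ π.toFinset

theorem Stmt.Valid.sub_drift_mem (h : S.Valid ρ) {π : List (Fin S.rows)} (hπ : S.Reached ρ π)
    {p : Fin k → ℤ} {x : Fin S.dim → ℤ} (hx : x ∈ S.piece ρ π p) :
    x - S.drift ρ π ∈ S.domain p := by
  induction π generalizing x with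
  | nil => simpa [Stmt.drift, Stmt.piece_nil] using hx
  | cons j π ih =>
    by_cases hj : 0 < S.cons.lin.mulVec (ρ π.toFinset) j
    · rw [Stmt.drift, if_pos hj]
      exact ih hπ.1 (h.mem_addSet hj hx).1
    · rw [Stmt.drift, if_neg hj, sub_add_eq_sub_sub_swap]
      exact ih hπ.1 (h.mem_subSet (lt_of_le_of_ne (not_lt.mp hj) hπ.2.2) hx).1

/-- Any property of vectors that holds for `0` and the vectors used and is stable under addition
holds for the drifts. -/
theorem Stmt.drift_induction {C : (Fin S.dim → ℤ) → Prop} (h0 : C 0) (hρ : ∀ I, C (ρ I))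
    (hadd : ∀ r r', C r → C r' → C (r + r')) (π : List (Fin S.rows)) : C (S.drift ρ π) := by
  induction π with
  | nil => exact h0
  | cons j π ih =>
    rw [Stmt.drift]
    split_ifs
    exacts [ih, hadd _ _ ih (hρ _)]

/-- Right-hand sides do not change along the drift. -/
theorem Stmt.Valid.loc_sub_drift (h : S.Valid ρ) (π : List (Fin S.rows))
    {a : Access Arr k S.dim} (ha : a ∈ S.rhs.refs) (p : Fin k → ℤ) (x : Fin S.dim → ℤ) :
    a.loc p (x - S.drift ρ π) = a.loc p x := by
  have h0 : a.idx.lin.mulVec (S.drift ρ π) = 0 :=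
    Stmt.drift_induction (C := fun r => a.idx.lin.mulVec r = 0) (by simp)
      (fun I => h.ref_eq_zero I a ha) (fun r r' hr hr' => by simp [Matrix.mulVec_add, hr, hr']) π
  have : a.idx.eval p (x - S.drift ρ π) = a.idx.eval p x := by
    funext i
    simp [Aff.eval_sub, h0]
  simp [Access.loc, this]

/-- The domain at a position lies in a neighbourhood of constant thickness of its face. -/
theorem Stmt.exists_piece_subset_thickFace (S : Stmt V Arr k)
    (ρ : Finset (Fin S.rows) → (Fin S.dim → ℤ)) (π : List (Fin S.rows)) :
    ∃ T : ℕ, ∀ p, S.piece ρ π p ⊆ S.thickFace π.toFinset T p := by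
  set b := S.subdomain ρ π
  refine ⟨∑ i, ((b.lo i).natAbs + ((b.hi i).untopD 0).natAbs), fun p x hx i => ?_⟩
  have hsum := Finset.single_le_sum (f := fun i => (b.lo i).natAbs + ((b.hi i).untopD 0).natAbs)
    (fun _ _ => Nat.zero_le _) (Finset.mem_univ i)
  have hxi : b.lo i ≤ S.cons.eval p x i ∧ (S.cons.eval p x i : WithTop ℤ) ≤ b.hi i := hx i
  refine ⟨by have := hxi.1; omega, fun hi => ?_⟩
  have htop : b.hi i ≠ ⊤ := Stmt.subdomain_hi_ne_top.mpr (by simpa using hi)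
  obtain ⟨c, hc⟩ := WithTop.ne_top_iff_exists.mp htop
  have hle := hxi.2
  rw [← hc] at hle
  have hle' : S.cons.eval p x i ≤ c := by exact_mod_cast hle
  rw [← hc, WithTop.untopD_coe] at hsum
  omega

theorem Stmt.exists_thickFace_translate (S : Stmt V Arr k) (I : Finset (Fin S.rows)) (T : ℕ)
    (r : Fin S.dim → ℤ) (K : ℕ) :
    ∃ T' : ℕ, ∀ p, ∀ x ∈ S.thickFace I T p, ∀ z : ℤ, |z| ≤ K →
      x + z • r ∈ S.thickFace I T' p := by
  refine ⟨T + K * ∑ i, (S.cons.lin.mulVec r i).natAbs, fun p x hx z hz i => ?_⟩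
  have hsum := Finset.single_le_sum (f := fun i => (S.cons.lin.mulVec r i).natAbs)
    (fun _ _ => Nat.zero_le _) (Finset.mem_univ i)
  have habs : |z * S.cons.lin.mulVec r i| ≤
      ((K * ∑ i, (S.cons.lin.mulVec r i).natAbs : ℕ) : ℤ) := by
    rw [abs_mul, ← Int.natCast_natAbs (S.cons.lin.mulVec r i), Nat.cast_mul]
    exact mul_le_mul hz (by exact_mod_cast hsum) (by positivity) (by positivity)
  rw [Aff.eval_add_zsmul, Nat.cast_add]
  have := abs_le.mp habs
  exact ⟨by linarith [(hx i).1], fun hi => by linarith [(hx i).2 hi]⟩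

end Stmt

/-! ### Points of an irreducible face end up in residual reductions nearby -/

section Walk
variable {V Arr : Type*} {k : ℕ}

/-- A walk along a line that does not stay in `D` for `K` steps leaves it at one of them. -/
theorem exists_last_mem {n : ℕ} {D : Set (Fin n → ℤ)} {x r : Fin n → ℤ} (hx : x ∈ D) {K : ℕ}
    (hK : x + (K : ℤ) • r ∉ D) :
    ∃ l : ℕ, l < K ∧ x + (l : ℤ) • r ∈ D ∧ x + ((l : ℤ) + 1) • r ∉ D := by
  induction K with
  | zero => simp [hx] at hK
  | succ K ih =>
    by_cases h : x + (K : ℤ) • r ∈ D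
    · exact ⟨K, K.lt_succ_self, h, by exact_mod_cast hK⟩
    · obtain ⟨l, hl, h'⟩ := ih h
      exact ⟨l, hl.trans K.lt_succ_self, h'⟩

/-- If the function number `j` is bounded at `x` and not constant along `r`, then one of the two
half shells is reached from `x` by a bounded number of steps along `r`. -/
theorem Box.exists_exit {n d : ℕ} (f : Aff k n d) (b : Box d) {r : Fin n → ℤ} {j : Fin d}
    (hj : f.lin.mulVec r j ≠ 0) (M : ℤ) :
    ∃ K : ℕ, ∀ p, ∀ x ∈ b.toSet f p, f.eval p x j ≤ M → ∃ z : ℤ, |z| ≤ K ∧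
      (x + z • r ∈ addSet r (b.toSet f p) ∨ x + z • r ∈ subSet r (b.toSet f p)) := by
  refine ⟨(M - b.lo j + 1).toNat, fun p x hx hM => ?_⟩
  set K := (M - b.lo j + 1).toNat
  have hlo := (hx j).1
  have hKle : M - b.lo j + 1 ≤ (K : ℤ) := Int.self_le_toNat _
  -- The walk goes in the direction in which the function number `j` decreases.
  rcases lt_or_gt_of_ne hj with hneg | hpos
  · have hout : x + (K : ℤ) • r ∉ b.toSet f p := fun hc => by
      have := (hc j).1
      rw [Aff.eval_add_zsmul] at this
      nlinarith
    obtain ⟨l, hl, hin, hnot⟩ := exists_last_mem hx hout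
    refine ⟨l + 1, ?_, Or.inr ⟨?_, hnot⟩⟩
    · rw [abs_of_nonneg (by positivity)]
      exact_mod_cast hl
    · have : x + ((l : ℤ) + 1) • r - r = x + (l : ℤ) • r := by
        rw [add_smul, one_smul]
        abel
      simpa only [shift, Set.mem_ofPred_eq, this] using hin
  · have hout : x + (K : ℤ) • (-r) ∉ b.toSet f p := fun hc => by
      have := (hc j).1
      rw [Aff.eval_add_zsmul, Matrix.mulVec_neg, Pi.neg_apply] at this
      nlinarith
    obtain ⟨l, hl, hin, hnot⟩ := exists_last_mem hx hout
    refine ⟨-l, ?_, Or.inl ⟨by simpa using hin, ?_⟩⟩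
    · rw [abs_neg, Nat.abs_cast]
      exact_mod_cast hl.le
    · have : x + (-(l : ℤ)) • r - r = x + ((l : ℤ) + 1) • (-r) := by
        rw [add_smul, one_smul, smul_neg, neg_smul]
        abel
      simpa only [shift, Set.mem_ofPred_eq, this] using hnot

variable {S : Stmt V Arr k} {ρ : Finset (Fin S.rows) → (Fin S.dim → ℤ)}

/-- Let the face `I` have no valid reuse vector, while the vectors of `ρ` share and project to
nonzero vectors. Then some inequality across which `I` has constant extent is not parallel to the
vector used at a position. So from every point near `I` a bounded number of steps along this vector
leads into a residual domain, and, after finitely many descents, into a residual reduction to which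
the transformation is not applied any more. The induction is on a bound `e` for the number of
inequalities that have not been passed yet. -/
theorem Stmt.Valid.exists_residual_near (h : S.Valid ρ)
    (hinv : ∀ o, S.red = some o → o.HasInverse) {I : Finset (Fin S.rows)}
    (hI : ¬ (S.candidates I).Nonempty) (e : ℕ) (π : List (Fin S.rows)) (hπ : S.Reached ρ π)
    (he : S.rows ≤ π.length + e) (T : ℕ) :
    ∃ F : Finset (Fin S.dim → ℤ), ∀ p, ∀ x ∈ S.thickFace I T p, x ∈ S.piece ρ π p →
      ∃ v ∈ F, ∃ π', S.Reached ρ π' ∧ ρ π'.toFinset = 0 ∧ x + v ∈ S.piece ρ π' p := by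
  induction e generalizing π T with
  | zero =>
    refine ⟨{0}, fun p x _ hx => ⟨0, by simp, π, hπ, ?_, by simpa using hx⟩⟩
    have hfull : π.toFinset = Finset.univ := by
      refine Finset.eq_univ_of_card _ (le_antisymm (Finset.card_le_univ _) ?_)
      rw [List.toFinset_card_of_nodup hπ.nodup, Fintype.card_fin]
      simpa using he
    -- A vector valid for the face of all inequalities is parallel to all of them, so valid for `I`.
    by_contra h0
    have hr := h _ h0
    refine hI ⟨ρ π.toFinset, ⟨⟨fun j _ => ?_, fun o ho hn => absurd (hinv o ho) hn⟩, hr.1.2⟩, hr.2⟩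
    exact h.lin_eq_zero (Stmt.constantExtent_of_mem (by simp [hfull]))
  | succ e ih =>
    by_cases h0 : ρ π.toFinset = 0
    · exact ⟨{0}, fun p x _ hx => ⟨0, by simp, π, hπ, h0, by simpa using hx⟩⟩
    obtain ⟨j, hj, hne⟩ : ∃ j, S.ConstantExtent I j ∧
        S.cons.lin.mulVec (ρ π.toFinset) j ≠ 0 := by
      by_contra! hcon
      have hr := h _ h0
      exact hI ⟨_, ⟨⟨hcon, fun o ho hn => absurd (hinv o ho) hn⟩, hr.1.2⟩, hr.2⟩
    obtain ⟨M, hM⟩ := hj T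
    obtain ⟨K, hK⟩ := Box.exists_exit S.cons (S.subdomain ρ π) hne M
    obtain ⟨T', hT'⟩ := S.exists_thickFace_translate I T (ρ π.toFinset) K
    choose! F hF using fun i (hi : S.IsChild ρ π i) =>
      ih (i :: π) ⟨hπ, hi⟩ (by simp only [List.length_cons]; omega) T'
    refine ⟨(Finset.univ ×ˢ Finset.Icc (-(K : ℤ)) K).biUnion fun iz =>
      (F iz.1).image fun v => iz.2 • ρ π.toFinset + v, fun p x hx hxπ => ?_⟩
    obtain ⟨z, hz, hexit⟩ := hK p x hxπ (hM p x hx)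
    obtain ⟨i, hi, hxi⟩ := h.exists_child hexit
    obtain ⟨v, hv, π', hπ', h0', hmem⟩ := hF i hi p _ (hT' p x hx z hz) hxi
    refine ⟨z • ρ π.toFinset + v, Finset.mem_biUnion.mpr ⟨(i, z), ?_, Finset.mem_image_of_mem _ hv⟩,
      π', hπ', h0', by rwa [← add_assoc]⟩
    simpa using abs_le.mp hz

end Walk

/-! ### Counting instances -/

section Count

theorem Sys.encard_dom_le_complexity {Arr Idx : Type*} {k : ℕ} (S : Sys Arr Idx k)
    (p : Fin k → ℤ) (σ : Idx) : (S.dom σ p).encard ≤ S.complexity p := by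
  have himg : (Sigma.mk (β := fun σ => Fin (S.dim σ) → ℤ) σ '' S.dom σ p).encard =
      (S.dom σ p).encard := sigma_mk_injective.encard_image _
  rw [Sys.complexity, ← himg]
  refine Set.encard_le_encard ?_
  rintro _ ⟨x, hx, rfl⟩
  exact hx

theorem encard_biUnion_le {α ι : Type*} (F : Finset ι) (A : ι → Set α) (c : ℕ∞)
    (h : ∀ i ∈ F, (A i).encard ≤ c) : (⋃ i ∈ F, A i).encard ≤ F.card * c := by
  classical
  induction F using Finset.induction_on with
  | empty => simp
  | insert i F hi ih =>
    rw [Finset.set_biUnion_insert, Finset.card_insert_of_notMem hi, Nat.cast_succ, add_mul, one_mul,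
      add_comm]
    exact (Set.encard_union_le _ _).trans (add_le_add (h i (by simp))
      (ih fun j hj => h j (Finset.mem_insert_of_mem hj)))

/-- If finitely many statements have instances, it suffices to bound the number of instances of each
one of them. -/
theorem Sys.complexity_le_of_dom_le {Arr Idx : Type*} {k : ℕ} (S : Sys Arr Idx k)
    (F : Finset Idx) (hF : ∀ σ p x, x ∈ S.dom σ p → σ ∈ F) (c : (Fin k → ℤ) → ℕ∞)
    (h : ∀ σ, ∃ C : ℕ, ∀ p, (S.dom σ p).encard ≤ C * c p) :
    ∃ C : ℕ, ∀ p, S.complexity p ≤ C * c p := by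
  choose C hC using h
  refine ⟨F.card * ∑ σ ∈ F, C σ, fun p => ?_⟩
  have hsub : {i : Σ σ, (Fin (S.dim σ) → ℤ) | i.2 ∈ S.dom i.1 p} ⊆
      ⋃ σ ∈ F, Sigma.mk σ '' S.dom σ p := by
    rintro ⟨σ, x⟩ hx
    exact Set.mem_biUnion (hF σ p x hx) (Set.mem_image_of_mem _ hx)
  refine (Set.encard_le_encard hsub).trans ?_
  rw [Nat.cast_mul, mul_assoc]
  refine encard_biUnion_le F _ _ fun σ hσ => ?_
  rw [(sigma_mk_injective (i := σ)).encard_image]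
  refine (hC σ p).trans (mul_le_mul_left ?_ _)
  exact_mod_cast Finset.single_le_sum (f := C) (fun _ _ => Nat.zero_le _) hσ

variable {V Arr : Type*} {k : ℕ} {P : Program V Arr k}

/-- Positions that are reached have no repetitions, so finitely many statements have instances. -/
theorem Program.exists_finset_dom (P : Program V Arr k) (ρ : P.Assignment) :
    ∃ F : Finset (TIdx P), ∀ σ p x, x ∈ (P.transformed ρ).dom σ p → σ ∈ F := by
  have hfin : {σ : TIdx P | ∃ p x, x ∈ (P.transformed ρ).dom σ p}.Finite := by
    refine Set.Finite.subset ((Set.finite_range (fun s : P.Plain => TIdx.plain s)).union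
      ((Set.finite_range (fun i : Σ s : P.Red, {π : List (Fin (P.stmt s).rows) // π.Nodup} =>
        TIdx.residual i.1 i.2.1)).union
      (Set.Finite.image (fun i : (Σ s : P.Red, {π : List (Fin (P.stmt s).rows) // π.Nodup}) × Role =>
        TIdx.combine i.1.1 i.1.2.1 i.2) (Set.finite_univ.prod
          (t := {.addOnly, .reuseOnly, .addReuse, .reuseSub, .addReuseSub}) (Set.toFinite _))))) ?_
    rintro (s | ⟨s, π⟩ | ⟨s, π, c⟩) ⟨p, x, hx⟩
    · exact Or.inl ⟨s, rfl⟩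
    · exact Or.inr (Or.inl ⟨⟨s, π, Stmt.Reached.nodup hx.1⟩, rfl⟩)
    · exact Or.inr (Or.inr ⟨(⟨s, π, Stmt.Reached.nodup hx.1⟩, c),
        ⟨Set.mem_univ _, by cases c <;> simp⟩, rfl⟩)
  exact ⟨hfin.toFinset, fun σ p x hx => hfin.mem_toFinset.mpr ⟨p, x, hx⟩⟩

/-- Every element of the left-hand side array is written, so their number is a lower bound for the
complexity of the transformed program, up to the number of roles. -/
theorem Program.encard_image_domain_le (P : Program V Arr k) (ρ : P.Assignment) (s : P.Red)
    (p : Fin k → ℤ) : ((P.stmt s).lhs.idx.eval p '' (P.stmt s).domain p).encard ≤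
      5 * (P.transformed ρ).complexity p := by
  classical
  by_cases h0 : ρ s ∅ = 0
  · refine (Set.encard_image_le _ _).trans ?_
    have hdom : (P.transformed ρ).dom (.residual s []) p = (P.stmt s).domain p := by
      rw [← Stmt.piece_nil (ρ := ρ s)]
      ext x
      simp [Program.transformed, Stmt.Reached, h0, Stmt.piece]
    rw [← hdom]
    refine ((P.transformed ρ).encard_dom_le_complexity p _).trans ?_
    exact le_mul_of_one_le_left zero_le (by norm_num)
  · let F : Finset Role := ⟨{.addOnly, .reuseOnly, .addReuse, .reuseSub, .addReuseSub}, by simp⟩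
    have hsub : (P.stmt s).lhs.idx.eval p '' (P.stmt s).domain p ⊆
        ⋃ c ∈ F, (P.transformed ρ).dom (.combine s [] c) p := by
      rintro _ ⟨x, hx, rfl⟩
      rw [← Stmt.piece_nil (ρ := ρ s)] at hx
      set D := (P.stmt s).piece (ρ s) [] p
      set f := (P.stmt s).lhs.idx.eval p
      have hu : f x ∈ f '' addSet (ρ s ∅) D ∨ f x ∈ f '' intSet (ρ s ∅) D := by
        by_cases hxr : x ∈ shift (ρ s ∅) D
        · exact Or.inr ⟨x, ⟨hx, hxr⟩, rfl⟩
        · exact Or.inl ⟨x, ⟨hx, hxr⟩, rfl⟩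
      have hrole : ∃ c : Role, f x ∈ c.dom (f '' addSet (ρ s ∅) D) (f '' subSet (ρ s ∅) D)
          (f '' intSet (ρ s ∅) D) := by
        by_cases ha : f x ∈ f '' addSet (ρ s ∅) D <;>
        by_cases hb : f x ∈ f '' subSet (ρ s ∅) D <;>
        by_cases hi : f x ∈ f '' intSet (ρ s ∅) D
        exacts [⟨.addReuseSub, ⟨hb, hi⟩, ha⟩, ⟨.addOnly, ha, hi⟩, ⟨.addReuse, ha, hi, hb⟩,
          ⟨.addOnly, ha, hi⟩, ⟨.reuseSub, hb, hi, ha⟩, absurd hu (by tauto),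
          ⟨.reuseOnly, hi, by simp only [Set.mem_union]; tauto⟩, absurd hu (by tauto)]
      obtain ⟨c, hc⟩ := hrole
      refine Set.mem_biUnion (x := c) (by cases c <;> simp [F]) ?_
      exact ⟨trivial, h0, hc⟩
    exact (Set.encard_le_encard hsub).trans (encard_biUnion_le F _ _ fun c _ =>
      (P.transformed ρ).encard_dom_le_complexity p _)

theorem Role.dom_subset {d : ℕ} (add sub int : Set (Fin d → ℤ)) (c : Role) :
    c.dom add sub int ⊆ add ∪ int := by
  intro u hu
  cases c <;> simp only [Role.dom, Set.mem_inter_iff, Set.mem_sdiff] at hu <;>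
    simp only [Set.mem_union] <;> tauto

/-- The statements that combine residual results write elements `proj x` with `x` in the domain at
their position. -/
theorem Program.combine_dom_subset (P : Program V Arr k) (ρ : P.Assignment) (s : P.Red)
    (π : List (Fin (P.stmt s).rows)) (c : Role) (p : Fin k → ℤ) :
    (P.transformed ρ).dom (.combine s π c) p ⊆
      (P.stmt s).lhs.idx.eval p '' (P.stmt s).piece (ρ s) π p := by
  rintro u ⟨-, -, hu⟩
  rcases Role.dom_subset _ _ _ c hu with ⟨x, hx, rfl⟩ | ⟨x, hx, rfl⟩
  exacts [⟨x, hx.1, rfl⟩, ⟨x, hx.1, rfl⟩]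

/-- If `ρ` applies the transformation along all faces that have a valid reuse vector, then the
program it gives is, up to a constant, at most as complex as the one that any valid assignment
gives. -/
theorem Program.complexity_le_of_applied
    (hinv : ∀ (s : Fin P.size) (o : RedOp V), (P.stmt s).red = some o → o.HasInverse)
    {ρ ρ' : P.Assignment} (hρ : ∀ s : P.Red, (P.stmt s).Valid (ρ s))
    (hρ' : ∀ s : P.Red, (P.stmt s).Valid (ρ' s))
    (hmax : ∀ (s : P.Red) I, ((P.stmt s).candidates I).Nonempty → ρ s I ≠ 0) :
    ∃ C : ℕ, ∀ p, (P.transformed ρ).complexity p ≤ C * (P.transformed ρ').complexity p := by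
  classical
  obtain ⟨F, hF⟩ := P.exists_finset_dom ρ
  refine (P.transformed ρ).complexity_le_of_dom_le F hF _ ?_
  rintro (s | ⟨s, π⟩ | ⟨s, π, c⟩)
  · refine ⟨1, fun p => ?_⟩
    rw [Nat.cast_one, one_mul]
    exact (P.transformed ρ').encard_dom_le_complexity p (.plain s)
  · by_cases hπ : (P.stmt s).Reached (ρ s) π ∧ ρ s π.toFinset = 0
    swap
    · refine ⟨0, fun p => ?_⟩
      have : (P.transformed ρ).dom (.residual s π) p = ∅ :=
        Set.eq_empty_of_forall_notMem fun x hx => hπ ⟨hx.1, hx.2.1⟩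
      simp [this]
    obtain ⟨hπ, h0⟩ := hπ
    have hI : ¬ ((P.stmt s).candidates π.toFinset).Nonempty := fun hc => hmax s _ hc h0
    obtain ⟨T, hT⟩ := (P.stmt s).exists_piece_subset_thickFace (ρ s) π
    set R := (P.stmt s).drift (ρ s) π
    obtain ⟨T', hT'⟩ := (P.stmt s).exists_thickFace_translate π.toFinset T R 1
    obtain ⟨W, hW⟩ := (hρ' s).exists_residual_near (hinv s) hI (P.stmt s).rows [] trivial
      (by simp) T'
    have hfin : {π' : List (Fin (P.stmt s).rows) | (P.stmt s).Reached (ρ' s) π'}.Finite :=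
      (Set.finite_range (fun l : {l : List (Fin (P.stmt s).rows) // l.Nodup} => l.1)).subset
        fun l hl => ⟨⟨l, Stmt.Reached.nodup hl⟩, rfl⟩
    refine ⟨(W ×ˢ hfin.toFinset).card, fun p => ?_⟩
    have hsub : (P.transformed ρ).dom (.residual s π) p ⊆ ⋃ i ∈ W ×ˢ hfin.toFinset,
        (fun y : Fin (P.stmt s).dim → ℤ => y - i.1 + R) ''
          (P.transformed ρ').dom (.residual s i.2) p := by
      rintro (x : Fin (P.stmt s).dim → ℤ) ⟨-, -, hx⟩
      have hxD := (hρ s).sub_drift_mem hπ hx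
      rw [← Stmt.piece_nil (ρ := ρ' s)] at hxD
      have hxT : x - R ∈ (P.stmt s).thickFace π.toFinset T' p := by
        have := hT' p x (hT p hx) (-1) (by simp)
        rwa [neg_one_smul, ← sub_eq_add_neg] at this
      obtain ⟨v, hv, π', hπ', h0', hmem⟩ := hW p _ hxT hxD
      refine Set.mem_biUnion (x := (v, π')) (by simp [hv, hπ']) ⟨x - R + v, ⟨hπ', h0', hmem⟩, ?_⟩
      exact (by rw [add_sub_cancel_right, sub_add_cancel] : x - R + v - v + R = x)
    refine (Set.encard_le_encard hsub).trans (encard_biUnion_le _ _ _ fun i _ => ?_)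
    exact (Set.encard_image_le _ _).trans ((P.transformed ρ').encard_dom_le_complexity p _)
  · by_cases hπ : (P.stmt s).Reached (ρ s) π
    swap
    · refine ⟨0, fun p => ?_⟩
      have : (P.transformed ρ).dom (.combine s π c) p = ∅ :=
        Set.eq_empty_of_forall_notMem fun x hx => hπ hx.1
      simp [this]
    refine ⟨5, fun p => le_trans ?_ (P.encard_image_domain_le ρ' s p)⟩
    set R := (P.stmt s).drift (ρ s) π
    have hsub : (P.transformed ρ).dom (.combine s π c) p ⊆
        (fun u : Fin (P.stmt s).lhs.ar → ℤ => u + (P.stmt s).proj R) ''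
          ((P.stmt s).lhs.idx.eval p '' (P.stmt s).domain p) := by
      intro (u : Fin (P.stmt s).lhs.ar → ℤ) hu
      obtain ⟨x, hx, rfl⟩ := P.combine_dom_subset ρ s π c p hu
      refine ⟨_, ⟨x - R, (hρ s).sub_drift_mem hπ hx, rfl⟩, ?_⟩
      dsimp only
      rw [Stmt.proj, ← Aff.eval_add, sub_add_cancel]
    exact (Set.encard_le_encard hsub).trans (Set.encard_image_le _ _)

end Count

/-! ### A schedule of the transformed program -/

section Schedule
variable {V Arr : Type*} {k m : ℕ} {P : Program V Arr k} {Θ : ∀ σ, Aff k (P.augmented.dim σ) m}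

/-- The scheduling function that the augmented program uses for a source statement. -/
def Program.instSched (P : Program V Arr k) (Θ : ∀ σ, Aff k (P.augmented.dim σ) m)
    (s : Fin P.size) : Aff k (P.stmt s).dim m :=
  Θ (Sum.inl s)

/-- The scheduling function that the augmented program uses for the left-hand side of a reduction,
that is, for the redirect statement. -/
def Program.lhsSched (P : Program V Arr k) (Θ : ∀ σ, Aff k (P.augmented.dim σ) m)
    (s : P.Red) : Aff k (P.stmt s).lhs.ar m :=
  Θ (Sum.inr s)

/-- The image of `proj r` under the linear part of the scheduling function of the left-hand
side. -/
def Program.advance (P : Program V Arr k) (Θ : ∀ σ, Aff k (P.augmented.dim σ) m) (s : P.Red)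
    (r : Fin (P.stmt s).dim → ℤ) : Fin m → ℤ :=
  (P.lhsSched Θ s).lin.mulVec ((P.stmt s).proj r)

theorem Program.lhsSched_add_proj (s : P.Red) (p : Fin k → ℤ) (u : Fin (P.stmt s).lhs.ar → ℤ)
    (r : Fin (P.stmt s).dim → ℤ) : (P.lhsSched Θ s).eval p (u + (P.stmt s).proj r) =
      (P.lhsSched Θ s).eval p u + P.advance Θ s r :=
  Aff.eval_add _ _ _ _

theorem Program.instSched_lt_lhsSched (hΘ : P.augmented.IsSchedule Θ) (s : P.Red) {p : Fin k → ℤ}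
    {x : Fin (P.stmt s).dim → ℤ} (hx : x ∈ (P.stmt s).domain p) :
    LexLt ((P.instSched Θ s).eval p x)
      ((P.lhsSched Θ s).eval p ((P.stmt s).lhs.idx.eval p x)) := by
  refine hΘ p (.inl s.1) x (.inr s) ((P.stmt s).lhs.idx.eval p x)
    ⟨hx, ⟨x, hx, rfl⟩, ⟨Sum.inr s.1, (P.stmt s).lhs.ar, Aff.translate k 0⟩, rfl,
      (Access.loc_translate_zero _ _ _).trans ?_⟩
  simp only [Program.augmented, Access.loc, Access.rename, if_pos s.2]

theorem Program.lhsSched_lt_instSched (hΘ : P.augmented.IsSchedule Θ) (s : P.Red)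
    {t : Fin P.size} {p : Fin k → ℤ} {x : Fin (P.stmt s).dim → ℤ} {y : Fin (P.stmt t).dim → ℤ}
    (hx : x ∈ (P.stmt s).domain p) (hy : y ∈ (P.stmt t).domain p)
    {a : Access Arr k (P.stmt t).dim} (ha : a ∈ (P.stmt t).rhs.refs)
    (hloc : a.loc p y = (P.stmt s).lhs.loc p x) :
    LexLt ((P.lhsSched Θ s).eval p ((P.stmt s).lhs.idx.eval p x))
      ((P.instSched Θ t).eval p y) := by
  refine hΘ p (.inr s) ((P.stmt s).lhs.idx.eval p x) (.inl t) y
    ⟨⟨x, hx, rfl⟩, hy, a.rename Sum.inl, ⟨a, ha, rfl⟩, ?_⟩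
  refine Eq.trans ?_ (Access.loc_translate_zero _ _ _).symm
  exact congrArg (fun l => (Sum.inl l.1, l.2)) hloc

theorem Program.instSched_lt_instSched (hΘ : P.augmented.IsSchedule Θ) (s : P.Plain)
    {t : Fin P.size} {p : Fin k → ℤ} {x : Fin (P.stmt s).dim → ℤ} {y : Fin (P.stmt t).dim → ℤ}
    (hx : x ∈ (P.stmt s).domain p) (hy : y ∈ (P.stmt t).domain p)
    {a : Access Arr k (P.stmt t).dim} (ha : a ∈ (P.stmt t).rhs.refs)
    (hloc : a.loc p y = (P.stmt s).lhs.loc p x) :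
    LexLt ((P.instSched Θ s).eval p x) ((P.instSched Θ t).eval p y) := by
  refine hΘ p (.inl s.1) x (.inl t) y ⟨hx, hy, a.rename Sum.inl, ⟨a, ha, rfl⟩, ?_⟩
  refine (congrArg (fun l => (Sum.inl l.1, l.2)) hloc).trans ?_
  simp only [Program.augmented, Access.loc, Access.rename, if_neg s.2]

/-- The schedule of the transformed program. A residual reduction runs when the original reduction
runs at the point of the original domain from which its point has drifted. The combining statements
for the element `u` run when the augmented program has `u` complete, those at deeper positions
first, and those at one position in the order of reuse. -/
def Program.transformedSchedule (P : Program V Arr k) (Θ : ∀ σ, Aff k (P.augmented.dim σ) m)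
    (ρ : P.Assignment) : ∀ σ, Aff k ((P.transformed ρ).dim σ) (m + 1 + 1)
  | .plain s => ((P.instSched Θ s).snoc 0 0).snoc 0 0
  | .residual s π => (((P.instSched Θ s).delay ((P.stmt s).drift (ρ s) π)).snoc 0 0).snoc 0 0
  | .combine s π _ =>
      ((P.lhsSched Θ s).snoc 0 (-(π.length : ℤ))).snoc ((P.stmt s).proj (ρ s π.toFinset)) 0

/-- The leading part of the schedule of the transformed program. -/
def Program.leadTime (P : Program V Arr k) (Θ : ∀ σ, Aff k (P.augmented.dim σ) m)
    (ρ : P.Assignment) (p : Fin k → ℤ) :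
    ∀ σ : TIdx P, (Fin ((P.transformed ρ).dim σ) → ℤ) → Fin m → ℤ
  | .plain s, x => (P.instSched Θ s).eval p x
  | .residual s π, x => ((P.instSched Θ s).delay ((P.stmt s).drift (ρ s) π)).eval p x
  | .combine s _ _, u => (P.lhsSched Θ s).eval p u

theorem Program.exists_eval_transformedSchedule (ρ : P.Assignment) (p : Fin k → ℤ) (σ : TIdx P)
    (x : Fin ((P.transformed ρ).dim σ) → ℤ) :
    ∃ c d : ℤ, (P.transformedSchedule Θ ρ σ).eval p x =
      (Fin.snoc (Fin.snoc (P.leadTime Θ ρ p σ x) c : Fin (m + 1) → ℤ) d : Fin (m + 1 + 1) → ℤ) := by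
  rcases σ with s | ⟨s, π⟩ | ⟨s, π, c⟩
  · exact ⟨_, _, Aff.eval_snoc_snoc (P.instSched Θ s) 0 0 0 0 p x⟩
  · exact ⟨_, _, Aff.eval_snoc_snoc ((P.instSched Θ s).delay _) 0 0 0 0 p x⟩
  · exact ⟨_, _, Aff.eval_snoc_snoc (P.lhsSched Θ s) 0 _ _ 0 p x⟩

theorem Program.eval_transformedSchedule_combine (ρ : P.Assignment) (p : Fin k → ℤ) (s : P.Red)
    (π : List (Fin (P.stmt s).rows)) (c : Role) (u : Fin (P.stmt s).lhs.ar → ℤ) :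
    Aff.eval (n := (P.stmt s).lhs.ar) (P.transformedSchedule Θ ρ (.combine s π c)) p u =
      (Fin.snoc (Fin.snoc ((P.lhsSched Θ s).eval p u) (-(π.length : ℤ)) : Fin (m + 1) → ℤ)
        ((P.stmt s).proj (ρ s π.toFinset) ⬝ᵥ u) : Fin (m + 1 + 1) → ℤ) := by
  refine (Aff.eval_snoc_snoc (P.lhsSched Θ s) 0 _ _ 0 p u).trans ?_
  rw [zero_dotProduct, zero_add, add_zero]

theorem Program.leadTime_residual (ρ : P.Assignment) (p : Fin k → ℤ) (s : P.Red)
    (π : List (Fin (P.stmt s).rows)) (x : Fin (P.stmt s).dim → ℤ) :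
    P.leadTime Θ ρ p (.residual s π) x =
      (P.instSched Θ s).eval p (x - (P.stmt s).drift (ρ s) π) :=
  Aff.eval_delay _ _ _ _

theorem Program.transformedSchedule_lt {ρ : P.Assignment} {p : Fin k → ℤ} {σ τ : TIdx P}
    {x : Fin ((P.transformed ρ).dim σ) → ℤ} {y : Fin ((P.transformed ρ).dim τ) → ℤ}
    (h : LexLt (P.leadTime Θ ρ p σ x) (P.leadTime Θ ρ p τ y)) :
    LexLt ((P.transformedSchedule Θ ρ σ).eval p x) ((P.transformedSchedule Θ ρ τ).eval p y) := by
  obtain ⟨c, d, hx⟩ := P.exists_eval_transformedSchedule (Θ := Θ) ρ p σ x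
  obtain ⟨c', d', hy⟩ := P.exists_eval_transformedSchedule (Θ := Θ) ρ p τ y
  rw [hx, hy]
  exact (h.snoc c c').snoc d d'

variable {ρ : P.Assignment}

/-- The instance of the transformed program that writes an element of an original array is over,
by the leading part of the schedule, before any source instance that reads this element. -/
theorem Program.leadTime_lt_instSched (hΘ : P.augmented.IsSchedule Θ) {p : Fin k → ℤ} {σ : TIdx P}
    {x : Fin ((P.transformed ρ).dim σ) → ℤ} (hx : x ∈ (P.transformed ρ).dom σ p)
    {t : Fin P.size} {y : Fin (P.stmt t).dim → ℤ} (hy : y ∈ (P.stmt t).domain p)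
    {a : Access Arr k (P.stmt t).dim} (ha : a ∈ (P.stmt t).rhs.refs)
    (hloc : (a.rename Sum.inl).loc p y = ((P.transformed ρ).write σ).loc p x) :
    LexLt (P.leadTime Θ ρ p σ x) ((P.instSched Θ t).eval p y) := by
  rcases σ with s | ⟨s, _ | ⟨j, π⟩⟩ | ⟨s, _ | ⟨j, π⟩, c⟩
  · refine P.instSched_lt_instSched hΘ s hx hy ha ?_
    simpa [Program.transformed, Access.loc, Access.rename] using hloc
  · change Fin (P.stmt s).dim → ℤ at x
    have hx' : x ∈ (P.stmt s).domain p := by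
      rw [← Stmt.piece_nil (ρ := ρ s)]
      exact hx.2.2
    have h1 := P.instSched_lt_lhsSched hΘ s hx'
    have h2 := P.lhsSched_lt_instSched hΘ s hx' hy ha
      (by simpa [Program.transformed, Access.loc, Access.rename, Program.arrayAt] using hloc)
    rw [P.leadTime_residual, Stmt.drift, sub_zero]
    exact lt_trans (lexLt_iff.mp h1) (lexLt_iff.mp h2)
  · simp [Program.transformed, Access.loc, Access.rename, Program.arrayAt] at hloc
  · obtain ⟨x, hx', rfl⟩ := P.combine_dom_subset ρ s [] c p hx
    rw [Stmt.piece_nil] at hx'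
    refine P.lhsSched_lt_instSched hΘ s hx' hy ha ?_
    simpa [Program.transformed, Access.loc, Access.rename, Program.arrayAt,
      Aff.eval_translate] using hloc
  · simp [Program.transformed, Access.loc, Access.rename, Program.arrayAt] at hloc

/-- The array of a position is written at this position only; for the original arrays, this holds
at the elements that the reduction writes, by static single assignment. -/
theorem Program.writer_of_arrayAt (hssa : P.IsSSA) {p : Fin k → ℤ} {σ : TIdx P}
    {x : Fin ((P.transformed ρ).dim σ) → ℤ} (hx : x ∈ (P.transformed ρ).dom σ p) {s : P.Red}
    {π : List (Fin (P.stmt s).rows)} {w : Fin (P.stmt s).lhs.ar → ℤ}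
    (hloc : ((P.transformed ρ).write σ).loc p x = (P.arrayAt s π, ⟨(P.stmt s).lhs.ar, w⟩))
    (hw : π = [] → ∃ x₀ ∈ (P.stmt s).domain p, (P.stmt s).lhs.idx.eval p x₀ = w) :
    (∃ x' : Fin (P.stmt s).dim → ℤ, (⟨σ, x⟩ : Σ σ, Fin ((P.transformed ρ).dim σ) → ℤ) =
        ⟨.residual s π, x'⟩ ∧ (P.stmt s).lhs.idx.eval p x' = w) ∨
      ∃ c, (⟨σ, x⟩ : Σ σ, Fin ((P.transformed ρ).dim σ) → ℤ) = ⟨.combine s π c, w⟩ := by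
  -- Two source statements that write the same element of an original array are equal.
  have key : π = [] → ∀ t : Fin P.size, ∀ y ∈ (P.stmt t).domain p,
      (Sum.inl (P.stmt t).lhs.arr : Arr ⊕ (Σ s : P.Red, List (Fin (P.stmt s).rows))) =
        P.arrayAt s π → (⟨(P.stmt t).lhs.ar, (P.stmt t).lhs.idx.eval p y⟩ : Σ d, Fin d → ℤ) =
        ⟨(P.stmt s).lhs.ar, w⟩ → t = s.1 := by
    rintro rfl t y hy h1 h2
    obtain ⟨x₀, hx₀, rfl⟩ := hw rfl
    by_contra hne
    refine hssa t s hne p y hy x₀ hx₀ ?_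
    rw [Access.loc, Access.loc, h2, Sum.inl.inj h1]
  have arrayAt_inj : ∀ (t : P.Red) (π' : List (Fin (P.stmt t).rows)),
      P.arrayAt t π' = P.arrayAt s π → (π = [] → π' = [] → t = s) →
      (⟨t, π'⟩ : Σ s : P.Red, List (Fin (P.stmt s).rows)) = ⟨s, π⟩ := by
    intro t π' h1 h2
    rcases π' with _ | ⟨j', π'⟩ <;> rcases π with _ | ⟨j, π⟩
    · obtain rfl := h2 rfl rfl
      rfl
    · cases h1
    · cases h1
    · exact Sum.inr.inj h1
  rcases σ with t | ⟨t, π'⟩ | ⟨t, π', c⟩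
  · obtain ⟨h1, h2⟩ := Prod.mk.inj hloc
    rcases π with _ | ⟨j, π⟩
    · exact absurd s.2 (key rfl t x hx h1 h2 ▸ t.2)
    · cases h1
  · obtain ⟨h1, h2⟩ := Prod.mk.inj hloc
    have h3 := arrayAt_inj t π' h1 fun hπ hπ' => by
      subst hπ'
      refine Subtype.ext (key hπ t x ?_ h1 h2)
      rw [← Stmt.piece_nil (ρ := ρ t)]
      exact hx.2.2
    cases h3
    exact Or.inl ⟨x, rfl, eq_of_heq (Sigma.mk.inj h2).2⟩
  · obtain ⟨h1, h2⟩ := Prod.mk.inj hloc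
    have h2' : (⟨(P.stmt t).lhs.ar, x⟩ : Σ d, Fin d → ℤ) = ⟨(P.stmt s).lhs.ar, w⟩ := by
      rw [← h2]
      exact congrArg _ ((Aff.eval_translate _ _ _).trans (add_zero _)).symm
    have h3 := arrayAt_inj t π' h1 fun hπ hπ' => by
      subst hπ'
      obtain ⟨y, hy, hyx⟩ := P.combine_dom_subset ρ t [] c p hx
      rw [Stmt.piece_nil] at hy
      exact Subtype.ext (key hπ t y hy h1 (by rw [hyx]; exact h2'))
    cases h3
    obtain rfl : x = w := eq_of_heq (Sigma.mk.inj h2').2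
    exact Or.inr ⟨c, rfl⟩

/-- Residual results are available when they are combined: the deeper position comes first. -/
theorem Program.transformedSchedule_child_lt (ρ : P.Assignment) (p : Fin k → ℤ) (s : P.Red)
    (π : List (Fin (P.stmt s).rows)) (j : Fin (P.stmt s).rows) (c c' : Role)
    (u : Fin (P.stmt s).lhs.ar → ℤ) :
    LexLt (Aff.eval (n := (P.stmt s).lhs.ar) (P.transformedSchedule Θ ρ (.combine s (j :: π) c)) p u)
      (Aff.eval (n := (P.stmt s).lhs.ar) (P.transformedSchedule Θ ρ (.combine s π c')) p u) := by
  rw [P.eval_transformedSchedule_combine, P.eval_transformedSchedule_combine]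
  refine (lexLt_snoc_of_lt _ ?_).snoc _ _
  simp

/-- The source of a reuse comes first: by the schedule of the augmented program if the vector moves
forward in it, and by the last coordinate if the vector does not move in it. -/
theorem Program.transformedSchedule_reuse_lt (p : Fin k → ℤ) (s : P.Red)
    (π : List (Fin (P.stmt s).rows)) (c c' : Role) (w : Fin (P.stmt s).lhs.ar → ℤ)
    (hadv : 0 ≤ toLex (P.advance Θ s (ρ s π.toFinset)))
    (hne : (P.stmt s).proj (ρ s π.toFinset) ≠ 0) :
    LexLt (Aff.eval (n := (P.stmt s).lhs.ar) (P.transformedSchedule Θ ρ (.combine s π c)) p w)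
      (Aff.eval (n := (P.stmt s).lhs.ar) (P.transformedSchedule Θ ρ (.combine s π c')) p
        (w + (P.stmt s).proj (ρ s π.toFinset))) := by
  rw [P.eval_transformedSchedule_combine, P.eval_transformedSchedule_combine, P.lhsSched_add_proj]
  rcases hadv.eq_or_lt with h0 | hpos
  · rw [← toLex_zero, toLex_inj] at h0
    rw [← h0, add_zero, dotProduct_add]
    refine lexLt_snoc_of_lt _ (lt_add_of_pos_right _ ?_)
    exact lt_of_le_of_ne (Finset.sum_nonneg fun i _ => mul_self_nonneg _)
      (fun h => hne (dotProduct_self_eq_zero.mp h.symm))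
  · exact (LexLt.snoc (lexLt_iff.mpr (lt_add_of_pos_right _ hpos)) _ _).snoc _ _

/-- If no vector that is used moves backwards in the schedule of the augmented program, then the
transformed program has a schedule. -/
theorem Program.transformed_isSchedule (hssa : P.IsSSA) (hΘ : P.augmented.IsSchedule Θ)
    (hρ : ∀ s : P.Red, (P.stmt s).Valid (ρ s))
    (hadv : ∀ (s : P.Red) I, 0 ≤ toLex (P.advance Θ s (ρ s I))) :
    (P.transformed ρ).IsSchedule (P.transformedSchedule Θ ρ) := by
  have hdrift : ∀ (s : P.Red) π, 0 ≤ toLex (P.advance Θ s ((P.stmt s).drift (ρ s) π)) :=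
    fun s π => Stmt.drift_induction (C := fun r => 0 ≤ toLex (P.advance Θ s r))
      (by simp [Program.advance, Stmt.proj]) (hadv s) (fun r r' hr hr' => by
        have : P.advance Θ s (r + r') = P.advance Θ s r + P.advance Θ s r' := by
          simp only [Program.advance, Stmt.proj, Matrix.mulVec_add]
        rw [this, toLex_add]
        exact add_nonneg hr hr') π
  rintro p σ x τ y ⟨hx, hy, a, ha, hloc⟩
  rcases τ with t | ⟨t, π⟩ | ⟨t, π, c⟩
  · obtain ⟨a, ha, rfl⟩ := ha
    exact P.transformedSchedule_lt (P.leadTime_lt_instSched hΘ hx hy ha hloc)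
  · change Fin (P.stmt t).dim → ℤ at y
    obtain ⟨a, ha, rfl⟩ := ha
    refine P.transformedSchedule_lt ?_
    -- The residual reduction reads at `y` what the original one reads at `y - drift`.
    rw [P.leadTime_residual]
    refine P.leadTime_lt_instSched hΘ hx ((hρ t).sub_drift_mem hy.1 hy.2.2) ha ?_
    rw [← hloc, Access.loc_rename, (hρ t).loc_sub_drift π ha p y]
    rfl
  · change Fin (P.stmt t).lhs.ar → ℤ at y
    rcases ha with ⟨hreuse, rfl⟩ | ⟨j, hj, -, rfl⟩
    · obtain ⟨w, rfl⟩ : ∃ w, y = w + (P.stmt t).proj (ρ t π.toFinset) :=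
        ⟨_, (sub_add_cancel _ _).symm⟩
      have hread := hloc.symm.trans (Access.loc_translate (d := (P.stmt t).lhs.ar) _ _ _ _)
      rw [add_neg_cancel_right] at hread
      have hint : w + (P.stmt t).proj (ρ t π.toFinset) ∈ (P.stmt t).lhs.idx.eval p ''
          intSet (ρ t π.toFinset) ((P.stmt t).piece (ρ t) π p) := by
        have hdom := hy.2.2
        cases c
        exacts [hreuse.elim, hdom.1, hdom.2.1, hdom.2.1, hdom.1.2]
      have hw : π = [] → ∃ x₀ ∈ (P.stmt t).domain p, (P.stmt t).lhs.idx.eval p x₀ = w := by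
        rintro rfl
        obtain ⟨x₀, ⟨-, hx₀⟩, hxw⟩ := hint
        refine ⟨x₀ - ρ t ∅, ?_, ?_⟩
        · rw [← Stmt.piece_nil (ρ := ρ t)]
          exact hx₀
        · rw [← sub_add_cancel x₀ (ρ t ∅), Aff.eval_add] at hxw
          exact add_right_cancel hxw
      rcases P.writer_of_arrayAt hssa hx hread hw with ⟨x', he, -⟩ | ⟨c', he⟩
      · cases he
        exact absurd hx.2.1 hy.2.1
      · cases he
        exact P.transformedSchedule_reuse_lt p t π c' c w (hadv t _) (hρ t _ hy.2.1).2
    · rcases P.writer_of_arrayAt hssa hx (hloc.symm.trans (Access.loc_translate_zero _ _ _))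
        (by simp) with ⟨x', he, hx'⟩ | ⟨c', he⟩
      · cases he
        refine P.transformedSchedule_lt ?_
        rw [P.leadTime_residual]
        have h1 := (P.instSched_lt_lhsSched hΘ t ((hρ t).sub_drift_mem hx.1 hx.2.2)).add_nonneg
          (hdrift t (j :: π))
        rw [← P.lhsSched_add_proj, Stmt.proj, ← Aff.eval_add, sub_add_cancel, hx'] at h1
        exact h1
      · cases he
        exact P.transformedSchedule_child_lt ρ p t π j c' c y

end Schedule

/-! ### The heuristic -/

section Heuristic
variable {V Arr : Type*} {k m : ℕ} {P : Program V Arr k} {Θ : ∀ σ, Aff k (P.augmented.dim σ) m}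

theorem Stmt.neg_mem_candidates {S : Stmt V Arr k} (hinv : ∀ o, S.red = some o → o.HasInverse)
    {I : Finset (Fin S.rows)} {r : Fin S.dim → ℤ} (hr : r ∈ S.candidates I) :
    -r ∈ S.candidates I := by
  refine ⟨⟨⟨fun j hj => ?_, fun o ho hn => absurd (hinv o ho) hn⟩, fun a ha => ?_⟩, ?_⟩
  · simpa [Matrix.mulVec_neg] using hr.1.1.1 j hj
  · simpa [Matrix.mulVec_neg] using hr.1.2 a ha
  · simpa [Stmt.proj, Matrix.mulVec_neg] using hr.2

theorem Stmt.ne_zero_of_mem_candidates {S : Stmt V Arr k} {I : Finset (Fin S.rows)}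
    {r : Fin S.dim → ℤ} (hr : r ∈ S.candidates I) : r ≠ 0 := by
  rintro rfl
  exact hr.2 (by simp [Stmt.proj])

theorem Program.advance_neg (s : P.Red) (r : Fin (P.stmt s).dim → ℤ) :
    P.advance Θ s (-r) = -P.advance Θ s r := by
  rw [Program.advance, Stmt.proj, Matrix.mulVec_neg, Matrix.mulVec_neg]
  rfl

variable {pick : P.Assignment}

/-- Without inverse condition the heuristic takes the picked vector or its negative. -/
theorem Program.heuristic_mem_candidates
    (hinv : ∀ (s : Fin P.size) (o : RedOp V), (P.stmt s).red = some o → o.HasInverse)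
    (hpick : ∀ (s : P.Red) I, ((P.stmt s).candidates I).Nonempty →
      pick s I ∈ (P.stmt s).candidates I) (s : P.Red) {I : Finset (Fin (P.stmt s).rows)}
    (hI : ((P.stmt s).candidates I).Nonempty) :
    P.heuristic Θ pick s I ∈ (P.stmt s).candidates I := by
  have hneg := Stmt.neg_mem_candidates (hinv s) (hpick s I hI)
  rw [Program.heuristic, if_pos hI]
  split_ifs
  exacts [hpick s I hI, hneg]

theorem Program.heuristic_valid
    (hinv : ∀ (s : Fin P.size) (o : RedOp V), (P.stmt s).red = some o → o.HasInverse)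
    (hpick : ∀ (s : P.Red) I, ((P.stmt s).candidates I).Nonempty →
      pick s I ∈ (P.stmt s).candidates I) (s : P.Red) :
    (P.stmt s).Valid (P.heuristic Θ pick s) := by
  intro I h0
  refine P.heuristic_mem_candidates hinv hpick s ?_
  by_contra hI
  exact h0 (by rw [Program.heuristic, if_neg hI])

/-- The order on timestamps is total, so if the picked vector does not move forward in the schedule
of the augmented program, then its negative does not move backwards. -/
theorem Program.heuristic_advance_nonneg (s : P.Red) (I : Finset (Fin (P.stmt s).rows)) :
    0 ≤ toLex (P.advance Θ s (P.heuristic Θ pick s I)) := by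
  have h0 : 0 ≤ toLex (P.advance Θ s 0) := by
    simp [Program.advance, Stmt.proj]
  rw [Program.heuristic]
  split_ifs with h1 h2 h3
  · exact (lexLt_iff.mp h2).le
  · rw [P.advance_neg, toLex_neg, Left.nonneg_neg_iff]
    exact not_lt.mp fun h => h2 (lexLt_iff.mpr h)
  · exact h0
  · exact h0

theorem Program.heuristic_feasible (hssa : P.IsSSA)
    (hinv : ∀ (s : Fin P.size) (o : RedOp V), (P.stmt s).red = some o → o.HasInverse)
    (hΘ : P.augmented.IsSchedule Θ)
    (hpick : ∀ (s : P.Red) I, ((P.stmt s).candidates I).Nonempty →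
      pick s I ∈ (P.stmt s).candidates I) : P.Feasible (P.heuristic Θ pick) :=
  ⟨P.heuristic_valid hinv hpick, _, _, P.transformed_isSchedule hssa hΘ
    (P.heuristic_valid hinv hpick) P.heuristic_advance_nonneg⟩

theorem Program.appliedFaces_subset_heuristic
    (hinv : ∀ (s : Fin P.size) (o : RedOp V), (P.stmt s).red = some o → o.HasInverse)
    (hpick : ∀ (s : P.Red) I, ((P.stmt s).candidates I).Nonempty →
      pick s I ∈ (P.stmt s).candidates I) {ρ : P.Assignment} (hρ : P.Feasible ρ) :
    P.appliedFaces ρ ⊆ P.appliedFaces (P.heuristic Θ pick) :=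
  fun f hf => Stmt.ne_zero_of_mem_candidates
    (P.heuristic_mem_candidates hinv hpick f.1 ⟨_, hρ.1 f.1 f.2 hf⟩)

end Heuristic
end MSSR

theorem mainTheorem2 {V Arr : Type*} {k : ℕ} (P : MSSR.Program V Arr k) (hssa : P.IsSSA)
    (hinv : ∀ (s : Fin P.size) (o : MSSR.RedOp V), (P.stmt s).red = some o → o.HasInverse)
    {m : ℕ} (Θ : ∀ σ, MSSR.Aff k (P.augmented.dim σ) m) (hΘ : P.augmented.IsSchedule Θ)
    (pick : P.Assignment)
    (hpick : ∀ (s : P.Red) (I : Finset (Fin (P.stmt s).rows)),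
      ((P.stmt s).candidates I).Nonempty → pick s I ∈ (P.stmt s).candidates I) :
    (∀ (s : P.Red) (I : Finset (Fin (P.stmt s).rows)), ((P.stmt s).candidates I).Nonempty →
      P.heuristic Θ pick s I ≠ 0 ∧ P.heuristic Θ pick s I ∈ (P.stmt s).candidates I) ∧
    (∀ ρ : P.Assignment, P.Feasible ρ →
      (P.appliedFaces ρ).ncard ≤ (P.appliedFaces (P.heuristic Θ pick)).ncard) ∧
    (∀ ρ : P.Assignment, P.Feasible ρ →
      (∀ ρ' : P.Assignment, P.Feasible ρ' →
        (P.appliedFaces ρ').ncard ≤ (P.appliedFaces ρ).ncard) → P.IsOptimal ρ) ∧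
    P.IsOptimal (P.heuristic Θ pick) := by
  have hmem := fun (s : P.Red) (I : Finset (Fin (P.stmt s).rows)) hI =>
    P.heuristic_mem_candidates (Θ := Θ) (I := I) hinv hpick s hI
  have hfeas := P.heuristic_feasible hssa hinv hΘ hpick
  have hsub := fun (ρ : P.Assignment) (hρ : P.Feasible ρ) =>
    P.appliedFaces_subset_heuristic (Θ := Θ) hinv hpick hρ
  have hcard := fun (ρ : P.Assignment) (hρ : P.Feasible ρ) =>
    Set.ncard_le_ncard (hsub ρ hρ) (Set.toFinite _)
  have hopt : ∀ ρ : P.Assignment, P.Feasible ρ → (∀ ρ' : P.Assignment, P.Feasible ρ' →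
      (P.appliedFaces ρ').ncard ≤ (P.appliedFaces ρ).ncard) → P.IsOptimal ρ := by
    refine fun ρ hρ hmax => ⟨hρ, fun ρ' hρ' =>
      P.complexity_le_of_applied hinv hρ.1 hρ'.1 fun s I hI => ?_⟩
    -- A maximal assignment uses the same faces as the heuristic, all those with a valid vector.
    have heq := Set.eq_of_subset_of_ncard_le (hsub ρ hρ) (hmax _ hfeas) (Set.toFinite _)
    have happ : (⟨s, I⟩ : Σ s : P.Red, Finset (Fin (P.stmt s).rows)) ∈ P.appliedFaces ρ := by
      rw [heq]
      exact MSSR.Stmt.ne_zero_of_mem_candidates (hmem s I hI)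
    exact happ
  exact ⟨fun s I hI => ⟨MSSR.Stmt.ne_zero_of_mem_candidates (hmem s I hI), hmem s I hI⟩, hcard,
    hopt, hopt _ hfeas hcard⟩
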